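/- Let $d\ge 1$ and $0<\lambda<\Lambda$. For $z_0=(t_0,x_0,v_0)\in\mathbb R\times\mathbb R^d\times\mathbb R^d$ and $r>0$ put $$Q_r(z_0)=\{(t,x,v):\ -r^2<t-t_0\le 0,\ |x-x_0-(t-t_0)v_0|<r^3,\ |v-v_0|<r\},$$ and write $Q_r=Q_r(0)$, $Q_1^-=Q_1((-2,0,0))=(-3,-2]\times B_1\times B_1$, $\langle f\rangle_{Q_1^-}=\frac1{|Q_1^-|}\int_{Q_1^-}f$, $a_+=\max(a,0)$ and $\mathcal T=\partial_t+v\cdot\nabla_x$. Consider $$\partial_t f+v\cdot\nabla_x f=\nabla_v\cdot(A\nabla_v f)+B\cdot\nabla_v f+S ,\qquad (*)$$ where $A=A(t,x,v)$ is a measurable symmetric real matrix field with eigenvalues in $[\lambda,\Lambda]$, $B=B(t,x,v)$ is a measurable vector field with $|B|\le\Lambda$, and $S=S(t,x,v)$ is a real function in $L^\infty$. A function $f$ is a weak sub-solution of $(*)$ on $\mathcal U=(a,b)\times\Omega_x\times\Omega_v$, with $\Omega_x,\Omega_v\subset\mathbb R^d$ open, if $f\in L^\infty((a,b);L^2(\Omega_x\times\Omega_v))\cap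 L^2((a,b)\times\Omega_x;H^1(\Omega_v))$ and, for all $\beta\in C^2(\mathbb R;\mathbb R)$ with $\beta'\ge0$ and $\beta''\ge0$ both bounded and all non-negative $\varphi\in C_c^\infty(\mathcal U)$, $$-\int_{\mathcal U}\beta(f)\,\mathcal T\varphi\,dz\le-\int_{\mathcal U}A\nabla_v\beta(f)\cdot\nabla_v\varphi\,dz+\int_{\mathcal U}\big[B\cdot\nabla_v\beta(f)+S\beta'(f)\big]\varphi\,dz .$$ A weak sub-solution on $Q_5$ is a weak sub-solution on its interior $(-25,0)\times B_{125}\times B_5$. There is a constant $C>0$ depending only on $d,\lambda,\Lambda$ such that for every $\varepsilon\in(0,1)$, every $\sigma\in(0,\tfrac13)$, all coefficients $A,B,S$ as above on $Q_5$, and every non-negative weak sub-solution $f$ of $(*)$ on $Q_5$, $$\big\|(f-\langle f\rangle_{Q_1^-})_+\big\|_{L^1(Q_1)}\le C\left(\frac1{\varepsilon^{d+2}}\|\nabla_v f\|_{L^1(Q_5)}+\varepsilon^\sigma\Big(\frac13-\sigma\Big)^{-1}\|f\|_{L^2(Q_5)}+\|S\|_{L^2(Q_5)}\right).$$ -/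

import Mathlib

open MeasureTheory
open scoped ContDiff

namespace Kinetic

/-- Points `z = (t, x, v)` with `t ∈ ℝ` and `x, v ∈ ℝ^d` (Euclidean norms on the `x` and `v`
factors; the volume is Lebesgue measure on `ℝ^{1+2d}`). -/
abbrev Point (d : ℕ) : Type :=
  ℝ × EuclideanSpace ℝ (Fin d) × EuclideanSpace ℝ (Fin d)

/-- The kinetic cylinder `Q_r(z₀)`:
`-r² < t - t₀ ≤ 0`, `|x - x₀ - (t - t₀) v₀| < r³`, `|v - v₀| < r`. -/
def cylinder {d : ℕ} (r : ℝ) (z₀ : Point d) : Set (Point d) :=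
  {z | -r ^ 2 < z.1 - z₀.1 ∧ z.1 - z₀.1 ≤ 0 ∧
    ‖z.2.1 - z₀.2.1 - (z.1 - z₀.1) • z₀.2.2‖ < r ^ 3 ∧ ‖z.2.2 - z₀.2.2‖ < r}

/-- The transport operator `𝒯 φ = ∂_t φ + v · ∇_x φ`, i.e. the derivative of `φ` at
`z = (t, x, v)` in the direction `(1, v, 0)`. -/
noncomputable def transport {d : ℕ} (φ : Point d → ℝ) (z : Point d) : ℝ :=
  fderiv ℝ φ z (1, z.2.2, 0)

/-- The classical gradient `∇_v φ` in the velocity variable. -/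
noncomputable def gradV {d : ℕ} (φ : Point d → ℝ) (z : Point d) : EuclideanSpace ℝ (Fin d) :=
  gradient (fun w => φ (z.1, z.2.1, w)) z.2.2

/-- Test functions `φ ∈ C_c^∞(U)`. -/
structure IsTest {d : ℕ} (U : Set (Point d)) (φ : Point d → ℝ) : Prop where
  smooth : ContDiff ℝ ∞ φ
  compact : HasCompactSupport φ
  support : tsupport φ ⊆ U

/-- `g` is the weak (distributional) gradient `∇_v h` of `h` on the open set `U`. It is unique up
to a null subset of `U`. -/
structure IsWeakGradV {d : ℕ} (U : Set (Point d)) (h : Point d → ℝ)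
    (g : Point d → EuclideanSpace ℝ (Fin d)) : Prop where
  locInt : LocallyIntegrableOn h U
  locInt_grad : LocallyIntegrableOn g U
  byParts : ∀ φ : Point d → ℝ, IsTest U φ →
    ∫ z in U, h z • gradV φ z = -(∫ z in U, φ z • g z)

/-- The assumptions on the coefficients of
`∂_t f + v · ∇_x f = ∇_v · (A ∇_v f) + B · ∇_v f + S` on `U`: `A` is a measurable symmetric matrix
field with eigenvalues in `[lam, Lam]`, `B` is a measurable vector field with `|B| ≤ Lam`, and
`S ∈ L^∞(U)`. -/
structure Coefficients {d : ℕ} (lam Lam : ℝ) (U : Set (Point d))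
    (A : Point d → Matrix (Fin d) (Fin d) ℝ) (B : Point d → EuclideanSpace ℝ (Fin d))
    (S : Point d → ℝ) : Prop where
  measurable_A : ∀ i j, AEMeasurable (fun z => A z i j) (volume.restrict U)
  symm_A : ∀ᵐ z ∂volume.restrict U, (A z).IsSymm
  eigenvalues_A : ∀ᵐ z ∂volume.restrict U, spectrum ℝ (A z) ⊆ Set.Icc lam Lam
  measurable_B : AEMeasurable B (volume.restrict U)
  bound_B : ∀ᵐ z ∂volume.restrict U, ‖B z‖ ≤ Lam
  bounded_S : MemLp S ⊤ (volume.restrict U)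

/-- Weak sub-solutions on `U = I × Ωx × Ωv` (`I` an open time interval, `Ωx`, `Ωv` open).
First two fields: `f ∈ L^∞(I; L²(Ωx × Ωv)) ∩ L²(I × Ωx; H¹(Ωv))`. Last field: the renormalised
inequality for all `C²` functions `β` with `β', β'' ≥ 0` bounded and all non-negative
`φ ∈ C_c^∞(U)`; there `G` is the weak gradient `∇_v β(f)`. -/
structure IsWeakSubsolution {d : ℕ} (I : Set ℝ) (Ωx Ωv : Set (EuclideanSpace ℝ (Fin d)))
    (A : Point d → Matrix (Fin d) (Fin d) ℝ) (B : Point d → EuclideanSpace ℝ (Fin d))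
    (S : Point d → ℝ) (f : Point d → ℝ) : Prop where
  bounded_energy : ∃ M : NNReal, ∀ᵐ t ∂volume.restrict I,
    eLpNorm (fun p : EuclideanSpace ℝ (Fin d) × EuclideanSpace ℝ (Fin d) => f (t, p)) 2
      (volume.restrict (Ωx ×ˢ Ωv)) ≤ M
  sobolev : MemLp f 2 (volume.restrict (I ×ˢ Ωx ×ˢ Ωv)) ∧
    ∃ g : Point d → EuclideanSpace ℝ (Fin d), IsWeakGradV (I ×ˢ Ωx ×ˢ Ωv) f g ∧
      MemLp g 2 (volume.restrict (I ×ˢ Ωx ×ˢ Ωv))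
  renormalized : ∀ β : ℝ → ℝ, ContDiff ℝ 2 β →
    (∃ M : ℝ, ∀ s, 0 ≤ deriv β s ∧ deriv β s ≤ M ∧
      0 ≤ deriv (deriv β) s ∧ deriv (deriv β) s ≤ M) →
    ∀ G : Point d → EuclideanSpace ℝ (Fin d),
      IsWeakGradV (I ×ˢ Ωx ×ˢ Ωv) (fun z => β (f z)) G →
    ∀ φ : Point d → ℝ, IsTest (I ×ˢ Ωx ×ˢ Ωv) φ → (∀ z, 0 ≤ φ z) →
      -(∫ z in I ×ˢ Ωx ×ˢ Ωv, β (f z) * transport φ z) ≤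
        -(∫ z in I ×ˢ Ωx ×ˢ Ωv, inner ℝ (Matrix.toEuclideanLin (A z) (G z)) (gradV φ z)) +
          ∫ z in I ×ˢ Ωx ×ˢ Ωv, (inner ℝ (B z) (G z) + S z * deriv β (f z)) * φ z

/-- The interior `(-r², 0) × B_{r³} × B_r` of `Q_r = Q_r(0)`, from which `Q_r` differs by a null
set. -/
def openCylinder (d : ℕ) (r : ℝ) : Set (Point d) :=
  Set.Ioo (-r ^ 2) 0 ×ˢ Metric.ball 0 (r ^ 3) ×ˢ Metric.ball 0 r

/-- `f` is a weak sub-solution on `Q_r = Q_r(0)`: the test functions are compactly supported in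
the interior of `Q_r`. -/
def IsWeakSubsolutionOnCylinder {d : ℕ} (r : ℝ)
    (A : Point d → Matrix (Fin d) (Fin d) ℝ) (B : Point d → EuclideanSpace ℝ (Fin d))
    (S : Point d → ℝ) (f : Point d → ℝ) : Prop :=
  IsWeakSubsolution (Set.Ioo (-r ^ 2) 0) (Metric.ball 0 (r ^ 3)) (Metric.ball 0 r) A B S f

end Kinetic

/-!
# A weak Poincaré inequality for kinetic sub-solutions

The proof is by duality. Fix a smooth probability density `η` on `midBox`, a small box around
`(-3/2, 0, 0)`. A test function `h` on the interior of `Q_1`, with values in `[0, 1]`, is regarded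
as a mass distribution and transported backwards in time to `(∫ h) η`. The transport has a mass
density `φ ≥ 0` and a flux `Ψ` in the velocity variable, both supported inside `Q_5`, with

  `𝒯 φ + ∇_v · Ψ = (∫ h) η - h`.

Multiplying by `f` and using the sub-solution property with the test function `φ` gives
`∫ f h ≤ (∫ h) ∫ f η + D`, where `D` is a multiple of `‖∇_v f‖_{L¹} + ‖S‖_{L¹}`; the multiple
depends on `d`, `Λ` and the suprema of `φ`, `∇_v φ` and `Ψ` only (`IsTransportPlan.integral_le`). The
reversal of time gives `(∫ h) ∫ f η ≤ ∫ f h + D` for `h` on the interior of `Q_1^-`. By approximation the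
first estimate holds for the indicator function of `{f > ⟨f⟩} ∩ Q_1`, and the second one for that
of `Q_1^-`, and together they bound `∫_{Q_1} (f - ⟨f⟩)_+` by a multiple of `D`. This is stronger
than the claim, since `1 ≤ ε ^ (-(d + 2))` and no term with `f` is needed on the right.

What has to be shown is that the suprema of `φ`, `∇_v φ` and `Ψ` are bounded in terms of the
supremum of `h`, whatever the derivatives of `h`. The mass is moved along trajectories `dx/dt = v`
that join each point of `lateBox` to all points of `midBox`. If `s` is the time since the later end,
then, up to fixed factors, `v` moves away from its initial value like `a s^(1/3) + b s^(2/3)`. For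
each `s > 0` the point of the trajectory depends on `(a, b)` in a non-degenerate way, so that a
velocity derivative of `h` can be replaced by derivatives in `(a, b)` and integrated by parts; this
costs at most `s^(-2/3)`, which is integrable, as is the flux, of order `s^(-2/3)`. With `s = S θ³`
everything is polynomial in `θ`, and no singular integral occurs: `fderiv_weight_vel` is the
computation behind the integration by parts, and `fderiv_weight_curve` the one behind the balance
equation. The resulting transport plans are `exists_transportPlan_late` and
`exists_transportPlan_early`.
-/

universe u

namespace Kinetic

variable {d : ℕ}

/-! ### Integrals depending on a parameter -/

theorem hasFDerivAt_setIntegral_of_contDiff {X Ω F : Type*}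
    [NormedAddCommGroup X] [NormedSpace ℝ X] [FiniteDimensional ℝ X]
    [NormedAddCommGroup Ω] [NormedSpace ℝ Ω] [FiniteDimensional ℝ Ω]
    [MeasurableSpace Ω] [BorelSpace Ω] [NormedAddCommGroup F] [NormedSpace ℝ F]
    (μ : Measure Ω) [IsFiniteMeasureOnCompacts μ] {K : Set Ω} (hK : IsCompact K)
    {G : X × Ω → F} (hG : ContDiff ℝ 1 G) (x : X) :
    HasFDerivAt (fun x => ∫ p in K, G (x, p) ∂μ)
      (∫ p in K, (fderiv ℝ G (x, p)).comp (ContinuousLinearMap.inl ℝ X Ω) ∂μ) x := by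
  have hD : Continuous fun q : X × Ω =>
      (fderiv ℝ G q).comp (ContinuousLinearMap.inl ℝ X Ω) :=
    (hG.continuous_fderiv one_ne_zero).clm_comp continuous_const
  have : ProperSpace X := FiniteDimensional.proper ℝ X
  obtain ⟨C, hC⟩ := ((isCompact_closedBall x 1).prod hK).exists_bound_of_continuousOn
    hD.continuousOn
  have : ProperSpace Ω := FiniteDimensional.proper ℝ Ω
  refine hasFDerivAt_integral_of_dominated_of_fderiv_le (bound := fun _ => C)
    (F' := fun y p => (fderiv ℝ G (y, p)).comp (ContinuousLinearMap.inl ℝ X Ω))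
    (Metric.ball_mem_nhds x one_pos) ?_ ?_ ?_ ?_ ?_ ?_
  · exact Filter.Eventually.of_forall fun y =>
      (hG.continuous.comp (Continuous.prodMk_right y)).aestronglyMeasurable
  · exact (hG.continuous.comp (Continuous.prodMk_right x)).continuousOn.integrableOn_compact hK
  · exact (hD.comp (Continuous.prodMk_right x)).aestronglyMeasurable
  · filter_upwards [ae_restrict_mem hK.measurableSet] with p hp y hy
    exact hC (y, p) ⟨Metric.ball_subset_closedBall hy, hp⟩
  · exact integrableOn_const hK.measure_lt_top.ne
  · refine Filter.Eventually.of_forall fun p y _ => ?_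
    have h1 : HasFDerivAt G (fderiv ℝ G (y, p)) (y, p) :=
      (hG.differentiable one_ne_zero).differentiableAt.hasFDerivAt
    exact h1.comp y (hasFDerivAt_prodMk_left y p)

theorem contDiff_setIntegral_of_contDiff {X F : Type u} {Ω : Type*}
    [NormedAddCommGroup X] [NormedSpace ℝ X] [FiniteDimensional ℝ X]
    [NormedAddCommGroup Ω] [NormedSpace ℝ Ω] [FiniteDimensional ℝ Ω]
    [MeasurableSpace Ω] [BorelSpace Ω] [NormedAddCommGroup F] [NormedSpace ℝ F]
    (μ : Measure Ω) [IsFiniteMeasureOnCompacts μ] {K : Set Ω} (hK : IsCompact K)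
    {G : X × Ω → F} (hG : ContDiff ℝ ∞ G) :
    ContDiff ℝ ∞ (fun x => ∫ p in K, G (x, p) ∂μ) := by
  rw [contDiff_infty]
  intro n
  induction n generalizing F with
  | zero =>
    exact contDiff_zero.2 (continuous_iff_continuousAt.2 fun x =>
      (hasFDerivAt_setIntegral_of_contDiff μ hK (hG.of_le (by simp)) x).continuousAt)
  | succ n ih =>
    have hfd := fun x => hasFDerivAt_setIntegral_of_contDiff μ hK
      (hG.of_le (m := 1) (by simp)) x
    rw [show ((n + 1 : ℕ) : WithTop ℕ∞) = (n : WithTop ℕ∞) + 1 by simp,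
      contDiff_succ_iff_fderiv]
    refine ⟨fun x => (hfd x).differentiableAt, by simp, ?_⟩
    rw [show (fderiv ℝ fun x => ∫ p in K, G (x, p) ∂μ) = fun x => ∫ p in K,
      (fderiv ℝ G (x, p)).comp (ContinuousLinearMap.inl ℝ X Ω) ∂μ from
        funext fun x => (hfd x).fderiv]
    exact ih (G := fun q => (fderiv ℝ G q).comp (ContinuousLinearMap.inl ℝ X Ω))
      ((hG.fderiv_right (m := ∞) (by simp)).clm_comp contDiff_const)

/-- The integral of a directional derivative of a compactly supported function vanishes. -/
theorem setIntegral_fderiv_eq_zero {Y : Type*}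
    [NormedAddCommGroup Y] [NormedSpace ℝ Y] [FiniteDimensional ℝ Y]
    [MeasurableSpace Y] [BorelSpace Y] (μ : Measure Y) [μ.IsAddHaarMeasure] {K : Set Y}
    (hK : IsCompact K) {g : Y → ℝ} (hg : ContDiff ℝ 1 g) (h0 : ∀ y ∉ K, g y = 0) (ξ : Y) :
    ∫ y in K, fderiv ℝ g y ξ ∂μ = 0 := by
  have hsupp : HasCompactSupport g := HasCompactSupport.intro hK h0
  have hd : HasCompactSupport fun y => fderiv ℝ g y ξ := hsupp.fderiv_apply (𝕜 := ℝ) ξ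
  have hdc : Continuous fun y => fderiv ℝ g y ξ :=
    (hg.continuous_fderiv one_ne_zero).clm_apply continuous_const
  have hzero : ∀ y ∉ K, fderiv ℝ g y ξ = 0 := by
    intro y hy
    have : g =ᶠ[nhds y] fun _ => 0 := by
      filter_upwards [hK.isClosed.isOpen_compl.mem_nhds hy] with x hx using h0 x hx
    rw [this.fderiv_eq]; simp
  rw [setIntegral_eq_integral_of_forall_compl_eq_zero hzero]
  have := integral_mul_fderiv_eq_neg_fderiv_mul_of_integrable (μ := μ) (f := fun _ : Y => (1 : ℝ))
    (g := g) (v := ξ) (by simp) (by simpa using hdc.integrable_of_hasCompactSupport hd)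
    (by simpa using hg.continuous.integrable_of_hasCompactSupport hsupp)
    (fun _ _ => differentiableAt_const _)
    (fun y _ => (hg.differentiable one_ne_zero).differentiableAt)
  simpa using this

/-! ### The trajectories -/

/-- Velocities and positions. -/
abbrev Vec (d : ℕ) : Type := EuclideanSpace ℝ (Fin d)

instance instIsAddHaarMeasureVecProd : (volume : Measure (Vec d × Vec d)).IsAddHaarMeasure :=
  Measure.prod.instIsAddHaarMeasure (volume : Measure (Vec d)) (volume : Measure (Vec d))

instance instIsAddHaarMeasurePoint : (volume : Measure (Point d)).IsAddHaarMeasure :=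
  Measure.prod.instIsAddHaarMeasure (volume : Measure ℝ) (volume : Measure (Vec d × Vec d))

/-- Parameters `(S, m, w)` of a trajectory: it lasts for the time `S`, its mean velocity exceeds
its velocity at the later end by `m`, and its velocity at the earlier end is smaller by `w`. -/
abbrev Jump (d : ℕ) : Type := ℝ × Vec d × Vec d

/-- `velShift θ m w` is the velocity at the curve parameter `θ ∈ [0, 1]` minus the one at the
later end `θ = 0`. -/
noncomputable def velShift (θ : ℝ) (m w : Vec d) : Vec d :=
  (4 * θ - 5 * θ ^ 2) • w + (20 / 3 * (θ - θ ^ 2)) • m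

/-- The derivative of `velShift` in `θ`. -/
noncomputable def velShiftDeriv (θ : ℝ) (m w : Vec d) : Vec d :=
  (4 - 10 * θ) • w + (20 / 3 * (1 - 2 * θ)) • m

/-- `∫₀^θ 3 τ² velShift τ dτ`: the displacement caused by `velShift`, for `S = 1`. -/
noncomputable def posShift (θ : ℝ) (m w : Vec d) : Vec d :=
  (3 * (θ ^ 4 - θ ^ 5)) • w + (5 * θ ^ 4 - 4 * θ ^ 5) • m

/-- The point with curve parameter `θ` on the trajectory that starts, backwards in time, at `z`.
It satisfies `dx/dt = v`, and time runs like `t = z.1 - S θ³`. -/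
noncomputable def traj (q : Point d × ℝ × Jump d) : Point d :=
  (q.1.1 - q.2.2.1 * q.2.1 ^ 3,
    q.1.2.1 - (q.2.2.1 * q.2.1 ^ 3) • q.1.2.2 - q.2.2.1 • posShift q.2.1 q.2.2.2.1 q.2.2.2.2,
    q.1.2.2 + velShift q.2.1 q.2.2.2.1 q.2.2.2.2)

/-- The later end of the trajectory that passes through `q.1` at the curve parameter `q.2.1`. -/
noncomputable def start (q : Point d × ℝ × Jump d) : Point d :=
  (q.1.1 + q.2.2.1 * q.2.1 ^ 3,
    q.1.2.1 + (q.2.2.1 * q.2.1 ^ 3) • (q.1.2.2 - velShift q.2.1 q.2.2.2.1 q.2.2.2.2) +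
      q.2.2.1 • posShift q.2.1 q.2.2.2.1 q.2.2.2.2,
    q.1.2.2 - velShift q.2.1 q.2.2.2.1 q.2.2.2.2)

/-- The earlier end of the trajectory with the later end `q.1`. -/
noncomputable def finish (q : Point d × Jump d) : Point d :=
  (q.1.1 - q.2.1, q.1.2.1 - q.2.1 • q.1.2.2 - q.2.1 • q.2.2.1, q.1.2.2 - q.2.2.2)

lemma contDiff_traj : ContDiff ℝ ∞ (traj (d := d)) := by
  unfold traj velShift posShift; fun_prop

lemma contDiff_start : ContDiff ℝ ∞ (start (d := d)) := by
  unfold start velShift posShift; fun_prop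

lemma contDiff_finish : ContDiff ℝ ∞ (finish (d := d)) := by
  unfold finish; fun_prop

lemma start_traj (z : Point d) (p : ℝ × Jump d) : start (traj (z, p), p) = z := by
  simp only [start, traj]
  ext1
  · simp
  ext1
  · simp only; module
  · simp

lemma traj_start (z : Point d) (p : ℝ × Jump d) : traj (start (z, p), p) = z := by
  simp only [start, traj]
  ext1
  · simp
  ext1
  · simp only; module
  · simp

lemma start_zero (z : Point d) (p : Jump d) : start (z, 0, p) = z := by
  simp [start, velShift, posShift]

lemma start_one (z : Point d) (p : Jump d) : start (z, 1, p) =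
    (z.1 + p.1, z.2.1 + p.1 • (z.2.2 + p.2.2) + p.1 • p.2.1, z.2.2 + p.2.2) := by
  simp only [start, velShift, posShift]
  ext1
  · simp
  ext1
  · simp only; module
  · simp only; module

lemma finish_start_one (z : Point d) (p : Jump d) : finish (start (z, 1, p), p) = z := by
  rw [start_one]
  simp only [finish]
  ext1
  · simp
  ext1
  · simp only; module
  · simp

/-- The density, with respect to the parameters, of the trajectories that pass through the point
`q.1` at the curve parameter `q.2.1`, if their later ends have the density `h` and their earlier
ends the density `η`. The factor `S ^ d` is the Jacobian of `finish` in the parameters. -/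
noncomputable def weight (h η : Point d → ℝ) (q : Point d × ℝ × Jump d) : ℝ :=
  q.2.2.1 ^ d * h (start q) * η (finish (start q, q.2.2))

lemma contDiff_weight {h η : Point d → ℝ} (hh : ContDiff ℝ ∞ h) (hη : ContDiff ℝ ∞ η) :
    ContDiff ℝ ∞ (weight h η) := by
  unfold weight
  have h1 : ContDiff ℝ ∞ fun q : Point d × ℝ × Jump d => start q := contDiff_start
  have h2 : ContDiff ℝ ∞ fun q : Point d × ℝ × Jump d => finish (start q, q.2.2) :=
    contDiff_finish.comp (h1.prodMk (by fun_prop))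
  exact ((by fun_prop : ContDiff ℝ ∞ fun q : Point d × ℝ × Jump d => q.2.2.1 ^ d).mul
    (hh.comp h1)).mul (hη.comp h2)

lemma hasDerivAt_traj (z : Point d) (θ : ℝ) (p : Jump d) :
    HasDerivAt (fun s => traj (z, s, p))
      (-(3 * p.1 * θ ^ 2) • ((1, (traj (z, θ, p)).2.2, 0) : Point d) +
        (0, 0, velShiftDeriv θ p.2.1 p.2.2)) θ := by
  have e1 : HasDerivAt (fun s : ℝ => p.1 * s ^ 3) (3 * p.1 * θ ^ 2) θ :=
    ((hasDerivAt_pow 3 θ).const_mul p.1).congr_deriv (by push_cast; ring)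
  have e2 : HasDerivAt (fun s : ℝ => 4 * s - 5 * s ^ 2) (4 - 10 * θ) θ :=
    (((hasDerivAt_id θ).const_mul 4).sub ((hasDerivAt_pow 2 θ).const_mul 5)).congr_deriv
      (by push_cast; ring)
  have e3 : HasDerivAt (fun s : ℝ => 20 / 3 * (s - s ^ 2)) (20 / 3 * (1 - 2 * θ)) θ :=
    (((hasDerivAt_id θ).sub (hasDerivAt_pow 2 θ)).const_mul (20 / 3)).congr_deriv
      (by push_cast; ring)
  have e4 : HasDerivAt (fun s : ℝ => 3 * (s ^ 4 - s ^ 5)) (12 * θ ^ 3 - 15 * θ ^ 4) θ :=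
    (((hasDerivAt_pow 4 θ).sub (hasDerivAt_pow 5 θ)).const_mul 3).congr_deriv
      (by push_cast; ring)
  have e5 : HasDerivAt (fun s : ℝ => 5 * s ^ 4 - 4 * s ^ 5) (20 * θ ^ 3 - 20 * θ ^ 4) θ :=
    (((hasDerivAt_pow 4 θ).const_mul 5).sub ((hasDerivAt_pow 5 θ).const_mul 4)).congr_deriv
      (by push_cast; ring)
  have hv : HasDerivAt (fun s => velShift s p.2.1 p.2.2) (velShiftDeriv θ p.2.1 p.2.2) θ :=
    (e2.smul_const p.2.2).add (e3.smul_const p.2.1)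
  have hx : HasDerivAt (fun s => posShift s p.2.1 p.2.2)
      ((12 * θ ^ 3 - 15 * θ ^ 4) • p.2.2 + (20 * θ ^ 3 - 20 * θ ^ 4) • p.2.1) θ :=
    (e4.smul_const p.2.2).add (e5.smul_const p.2.1)
  have := (e1.const_sub z.1).prodMk ((((e1.smul_const z.2.2).const_sub z.2.1).sub
    (hx.const_smul p.1)).prodMk (hv.const_add z.2.2))
  refine HasDerivAt.congr_deriv (f := fun s => traj (z, s, p)) this ?_
  ext1
  · simp
  ext1
  · simp only [traj, velShift, Prod.snd_add, Prod.fst_add, Prod.smul_snd, Prod.smul_fst]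
    module
  · simp

/-- Along each trajectory the weight is constant. -/
lemma fderiv_weight_curve {h η : Point d → ℝ} (hh : ContDiff ℝ ∞ h) (hη : ContDiff ℝ ∞ η)
    (z : Point d) (θ : ℝ) (p : Jump d) :
    fderiv ℝ (weight h η) (z, θ, p) (0, 1, 0) =
      3 * p.1 * θ ^ 2 * fderiv ℝ (weight h η) (z, θ, p) ((1, z.2.2, 0), 0) -
        fderiv ℝ (weight h η) (z, θ, p) ((0, 0, velShiftDeriv θ p.2.1 p.2.2), 0) := by
  set z₁ := start (z, θ, p) with hz₁
  have ht : traj (z₁, θ, p) = z := traj_start z (θ, p)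
  have h1 := (hasDerivAt_traj z₁ θ p).prodMk ((hasDerivAt_id θ).prodMk (hasDerivAt_const θ p))
  have h2 : HasFDerivAt (weight h η) (fderiv ℝ (weight h η) (z, θ, p))
      (traj (z₁, θ, p), id θ, p) := by
    rw [ht]
    exact ((contDiff_weight hh hη).differentiable (by simp)).differentiableAt.hasFDerivAt
  have h3 := h2.comp_hasDerivAt θ h1
  have h4 : (weight h η ∘ fun s => (traj (z₁, s, p), id s, p)) =
      fun _ => p.1 ^ d * h z₁ * η (finish (z₁, p)) := by
    funext s
    simp only [Function.comp, weight, id, start_traj]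
  rw [h4, ht] at h3
  have h5 := h3.unique (hasDerivAt_const θ _)
  have h6 : ((-(3 * p.1 * θ ^ 2) • ((1, z.2.2, 0) : Point d) +
      (0, 0, velShiftDeriv θ p.2.1 p.2.2), (1 : ℝ), (0 : Jump d)) : Point d × ℝ × Jump d) =
      -(3 * p.1 * θ ^ 2) • (((1, z.2.2, 0), 0) : Point d × ℝ × Jump d) +
        ((0, 0, velShiftDeriv θ p.2.1 p.2.2), 0) + (0, 1, 0) := by
    simp
  rw [h6, map_add, map_add, map_smul, smul_eq_mul] at h5
  linarith

/-- Moving the point in velocity by `θ² e` while moving the parameters so that the later end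
stays fixed turns a velocity derivative of the weight into a derivative of `η` only. The
coefficients are polynomials in `θ`, so nothing is lost near the later end `θ = 0`. -/
lemma fderiv_weight_vel {h η : Point d → ℝ} (hh : ContDiff ℝ ∞ h) (hη : ContDiff ℝ ∞ η)
    (z : Point d) (θ : ℝ) (p : Jump d) (e : Vec d) :
    θ ^ 2 * fderiv ℝ (weight h η) (z, θ, p) ((0, 0, e), 0) =
      p.1 ^ d * h (start (z, θ, p)) * fderiv ℝ η (finish (start (z, θ, p), p))
          (0, -(3 * (1 - θ) * p.1) • e, (5 - 4 * θ) • e) -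
        fderiv ℝ (weight h η) (z, θ, p) (0, 0, 0, (3 * (1 - θ)) • e, -(5 - 4 * θ) • e) := by
  set ξ : Point d × ℝ × Jump d := ((0, 0, θ ^ 2 • e), 0, 0, (3 * (1 - θ)) • e, -(5 - 4 * θ) • e)
    with hξ
  set κ : Point d := (0, -(3 * (1 - θ) * p.1) • e, (5 - 4 * θ) • e) with hκ
  have hline : ∀ {X : Type} [NormedAddCommGroup X] [NormedSpace ℝ X] (x y : X),
      HasDerivAt (fun s : ℝ => x + s • y) y 0 := fun x y => by
    simpa using ((hasDerivAt_id (0 : ℝ)).smul_const y).const_add x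
  have hs : ∀ s : ℝ, start ((z, θ, p) + s • ξ) = start (z, θ, p) := by
    intro s
    simp only [start, hξ, velShift, posShift]
    ext1
    · simp
    ext1
    · simp only [Prod.snd_add, Prod.fst_add, Prod.smul_snd, Prod.smul_fst, smul_zero, add_zero]
      module
    · simp only [Prod.snd_add, Prod.fst_add, Prod.smul_snd, Prod.smul_fst, smul_zero, add_zero]
      module
  have hf : ∀ s : ℝ, finish (start (z, θ, p), ((z, θ, p) + s • ξ).2.2) =
      finish (start (z, θ, p), p) + s • κ := by
    intro s
    simp only [finish, hξ, hκ]
    ext1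
    · simp
    ext1
    · simp only [Prod.snd_add, Prod.fst_add, Prod.smul_snd, Prod.smul_fst, smul_zero, add_zero]
      module
    · simp only [Prod.snd_add, Prod.smul_snd]
      module
  have h1 : HasDerivAt (fun s : ℝ => weight h η ((z, θ, p) + s • ξ))
      (fderiv ℝ (weight h η) (z, θ, p) ξ) 0 := by
    have : HasFDerivAt (weight h η) (fderiv ℝ (weight h η) (z, θ, p))
        ((z, θ, p) + (0 : ℝ) • ξ) := by
      rw [zero_smul, add_zero]
      exact ((contDiff_weight hh hη).differentiable (by simp)).differentiableAt.hasFDerivAt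
    exact this.comp_hasDerivAt 0 (hline _ _)
  have h2 : HasDerivAt (fun s : ℝ => weight h η ((z, θ, p) + s • ξ))
      (p.1 ^ d * h (start (z, θ, p)) * fderiv ℝ η (finish (start (z, θ, p), p)) κ) 0 := by
    have : HasFDerivAt η (fderiv ℝ η (finish (start (z, θ, p), p)))
        (finish (start (z, θ, p), p) + (0 : ℝ) • κ) := by
      rw [zero_smul, add_zero]
      exact (hη.differentiable (by simp)).differentiableAt.hasFDerivAt
    have h3 := (this.comp_hasDerivAt 0 (hline _ _)).const_mul (p.1 ^ d * h (start (z, θ, p)))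
    have h4 : (fun s : ℝ => weight h η ((z, θ, p) + s • ξ)) = fun s : ℝ =>
        p.1 ^ d * h (start (z, θ, p)) * (η ∘ fun s => finish (start (z, θ, p), p) + s • κ) s := by
      funext s
      simp only [weight, hs, hf, Function.comp]
      simp [hξ]
    rw [h4]
    exact h3
  have h3 := h1.unique h2
  have h4 : ξ = θ ^ 2 • (((0, 0, e), 0) : Point d × ℝ × Jump d) +
      (0, 0, 0, (3 * (1 - θ)) • e, -(5 - 4 * θ) • e) := by
    simp [hξ]
  rw [h4, map_add, map_smul, smul_eq_mul] at h3
  linarith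

/-! ### Confinement of the trajectories -/

/-- The interior of `Q_1`. -/
def lateBox (d : ℕ) : Set (Point d) :=
  Set.Ioo (-1) 0 ×ˢ Metric.ball 0 1 ×ˢ Metric.ball 0 1

/-- The interior of `Q_1^- = Q_1((-2, 0, 0))`. -/
def earlyBox (d : ℕ) : Set (Point d) :=
  Set.Ioo (-3) (-2) ×ˢ Metric.ball 0 1 ×ˢ Metric.ball 0 1

/-- A small box half-way in time between `lateBox` and `earlyBox`. It has to be so small that the
trajectories that join it to `lateBox` have speed less than `5`. -/
def midBox (d : ℕ) : Set (Point d) :=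
  Set.Ioo (-(31 / 20)) (-(29 / 20)) ×ˢ Metric.ball 0 (1 / 20) ×ˢ Metric.ball 0 (1 / 20)

/-- A set that contains all trajectories from `lateBox` to `midBox`. The lower bound of the time is
such that the image under `reversal` lies inside `Q_5` as well. -/
def lateTube (d : ℕ) : Set (Point d) :=
  Set.Ioo (-2) 0 ×ˢ Metric.ball 0 (5 ^ 3) ×ˢ Metric.ball 0 5

/-- A compact set that contains the parameters of all trajectories from `lateBox` to `midBox`. -/
def jumpBox (d : ℕ) : Set (Jump d) :=
  Set.Icc 0 2 ×ˢ Metric.closedBall 0 4 ×ˢ Metric.closedBall 0 2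

lemma isCompact_jumpBox : IsCompact (jumpBox d) :=
  isCompact_Icc.prod ((isCompact_closedBall _ _).prod (isCompact_closedBall _ _))

lemma isOpen_lateBox : IsOpen (lateBox d) :=
  isOpen_Ioo.prod (Metric.isOpen_ball.prod Metric.isOpen_ball)

lemma isOpen_earlyBox : IsOpen (earlyBox d) :=
  isOpen_Ioo.prod (Metric.isOpen_ball.prod Metric.isOpen_ball)

lemma isOpen_openCylinder (r : ℝ) : IsOpen (openCylinder d r) :=
  isOpen_Ioo.prod (Metric.isOpen_ball.prod Metric.isOpen_ball)

lemma jump_bounds {z : Point d} {p : Jump d} (hz : z ∈ lateBox d)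
    (hf : finish (z, p) ∈ midBox d) :
    9 / 20 < p.1 ∧ p.1 < 31 / 20 ∧ ‖p.2.1 + z.2.2‖ ≤ 7 / 3 ∧ ‖p.2.2‖ ≤ 21 / 20 := by
  obtain ⟨t, x, v⟩ := z
  obtain ⟨S, m, w⟩ := p
  simp only [lateBox, midBox, finish, Set.mem_prod, Set.mem_Ioo, mem_ball_zero_iff] at hz hf
  obtain ⟨⟨ht1, ht0⟩, hx, hv⟩ := hz
  obtain ⟨⟨hs1, hs0⟩, hx0, hv0⟩ := hf
  have hS1 : 9 / 20 < S := by linarith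
  refine ⟨hS1, by linarith, ?_, ?_⟩
  -- `m + v` is the mean velocity: a distance of at most `21 / 20` in a time of at least `9 / 20`
  · have h1 : S • (m + v) = x - (x - S • v - S • m) := by module
    have h2 : ‖S • (m + v)‖ ≤ 21 / 20 := by
      rw [h1]; exact (norm_sub_le _ _).trans (by linarith)
    rw [norm_smul, Real.norm_of_nonneg (by linarith)] at h2
    have h3 : 9 / 20 * ‖m + v‖ ≤ S * ‖m + v‖ :=
      mul_le_mul_of_nonneg_right hS1.le (norm_nonneg _)
    simp only
    linarith
  · have h1 : w = v - (v - w) := by module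
    simp only
    rw [h1]
    exact (norm_sub_le _ _).trans (by linarith)

lemma mem_jumpBox {z : Point d} {p : Jump d} (hz : z ∈ lateBox d)
    (hf : finish (z, p) ∈ midBox d) : p ∈ jumpBox d := by
  obtain ⟨h1, h2, h3, h4⟩ := jump_bounds hz hf
  simp only [jumpBox, Set.mem_prod, Set.mem_Icc, mem_closedBall_zero_iff]
  refine ⟨⟨by linarith, by linarith⟩, ?_, by linarith⟩
  have h5 : p.2.1 = (p.2.1 + z.2.2) - z.2.2 := by module
  have h6 : ‖z.2.2‖ < 1 := by simpa using hz.2.2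
  rw [h5]
  exact (norm_sub_le _ _).trans (by linarith)

lemma traj_mem {z : Point d} {p : Jump d} (hz : z ∈ lateBox d)
    (hf : finish (z, p) ∈ midBox d) {θ : ℝ} (hθ : θ ∈ Set.Icc (0 : ℝ) 1) :
    traj (z, θ, p) ∈ lateTube d := by
  obtain ⟨hS1, hS2, hm, hw⟩ := jump_bounds hz hf
  have hp := mem_jumpBox hz hf
  obtain ⟨t, x, v⟩ := z
  obtain ⟨S, m, w⟩ := p
  simp only [lateBox, midBox, jumpBox, finish, Set.mem_prod, Set.mem_Ioo, mem_ball_zero_iff,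
    Set.mem_Icc, mem_closedBall_zero_iff] at hz hf hm hw hp hS1 hS2
  obtain ⟨⟨ht1, ht0⟩, hx, hv⟩ := hz
  obtain ⟨⟨hs1, hs0⟩, hx0, hv0⟩ := hf
  obtain ⟨-, hm4, hw2⟩ := hp
  obtain ⟨hθ0, hθ1⟩ := hθ
  have t2 : θ ^ 2 ≤ 1 := pow_le_one₀ hθ0 hθ1
  have t3 : θ ^ 3 ≤ 1 := pow_le_one₀ hθ0 hθ1
  have t3' : 0 ≤ θ ^ 3 := by positivity
  have t4 : θ ^ 4 ≤ 1 := pow_le_one₀ hθ0 hθ1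
  have t4' : 0 ≤ θ ^ 4 := by positivity
  have t5' : 0 ≤ θ ^ 5 := by positivity
  have t45 : θ ^ 5 ≤ θ ^ 4 := pow_le_pow_of_le_one hθ0 hθ1 (by norm_num)
  have hSt : S * θ ^ 3 ≤ S := mul_le_of_le_one_right (by linarith) t3
  have hSt' : 0 ≤ S * θ ^ 3 := mul_nonneg (by linarith) t3'
  simp only [lateTube, traj, Set.mem_prod, Set.mem_Ioo, mem_ball_zero_iff]
  have hsm : ∀ {a b c : ℝ} {u : Vec d}, |a| ≤ b → ‖u‖ ≤ c → ‖a • u‖ ≤ b * c :=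
    fun ha hu => by
      rw [norm_smul]
      exact mul_le_mul ha hu (norm_nonneg _) ((abs_nonneg _).trans ha)
  refine ⟨⟨by linarith, by linarith⟩, ?_, ?_⟩
  · have hX : ‖posShift θ m w‖ ≤ 3 * 2 + 5 * 4 := by
      refine (norm_add_le _ _).trans (add_le_add (hsm ?_ hw2) (hsm ?_ hm4))
      · rw [abs_le]; constructor <;> linarith
      · rw [abs_le]; constructor <;> linarith
    have h1 : ‖(S * θ ^ 3) • v‖ ≤ 31 / 20 * 1 :=
      hsm (by rw [abs_of_nonneg hSt']; linarith) hv.le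
    have h2 : ‖S • posShift θ m w‖ ≤ 31 / 20 * (3 * 2 + 5 * 4) :=
      hsm (by rw [abs_of_nonneg (by linarith)]; linarith) hX
    refine (norm_sub_le _ _).trans_lt ?_
    have := norm_sub_le x ((S * θ ^ 3) • v)
    linarith
  -- the velocity in terms of the velocities at both ends and the mean velocity `m + v`; the three
  -- bounds add up to `1 + 1 / 20 + 35 / 9 < 5`
  · have h1 : v + velShift θ m w = ((1 - θ) * (1 - 5 / 3 * θ)) • v -
        (4 * θ - 5 * θ ^ 2) • (v - w) + (20 / 3 * (θ - θ ^ 2)) • (m + v) := by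
      simp only [velShift]; module
    have h2 : ‖((1 - θ) * (1 - 5 / 3 * θ)) • v‖ ≤ 1 * 1 :=
      hsm (by rw [abs_le]; constructor <;> nlinarith) hv.le
    have h3 : ‖(4 * θ - 5 * θ ^ 2) • (v - w)‖ ≤ 1 * (1 / 20) :=
      hsm (by rw [abs_le]; constructor <;> nlinarith [sq_nonneg (5 * θ - 2)]) hv0.le
    have h4 : ‖(20 / 3 * (θ - θ ^ 2)) • (m + v)‖ ≤ 5 / 3 * (7 / 3) :=
      hsm (by rw [abs_le]; constructor <;> nlinarith [sq_nonneg (2 * θ - 1)]) hm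
    rw [h1]
    have h5 := norm_add_le (((1 - θ) * (1 - 5 / 3 * θ)) • v - (4 * θ - 5 * θ ^ 2) • (v - w))
      ((20 / 3 * (θ - θ ^ 2)) • (m + v))
    have h6 := norm_sub_le (((1 - θ) * (1 - 5 / 3 * θ)) • v) ((4 * θ - 5 * θ ^ 2) • (v - w))
    linarith

lemma weight_ne_zero {h η : Point d → ℝ} (hh : IsTest (lateBox d) h) (hη : IsTest (midBox d) η)
    {q : Point d × ℝ × Jump d} (hq : weight h η q ≠ 0) :
    start q ∈ tsupport h ∧ finish (start q, q.2.2) ∈ tsupport η ∧ q.2.2 ∈ jumpBox d := by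
  have h1 : h (start q) ≠ 0 := fun h0 => hq (by simp [weight, h0])
  have h2 : η (finish (start q, q.2.2)) ≠ 0 := fun h0 => hq (by simp [weight, h0])
  have h3 := subset_tsupport _ h1
  have h4 := subset_tsupport _ h2
  exact ⟨h3, h4, mem_jumpBox (hh.support h3) (hη.support h4)⟩

/-- The parameter set of the trajectory integrals. -/
def paramBox (d : ℕ) : Set (ℝ × Jump d) := Set.Icc 0 1 ×ˢ jumpBox d

lemma isCompact_paramBox : IsCompact (paramBox d) := isCompact_Icc.prod isCompact_jumpBox

/-- Superpositions of the trajectories from `lateBox` to `midBox` are test functions. -/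
lemma isTest_trajIntegral {h η : Point d → ℝ} (hh : IsTest (lateBox d) h)
    (hη : IsTest (midBox d) η) {c : ℝ × Jump d → ℝ} (hc : ContDiff ℝ ∞ c) :
    IsTest (lateTube d) fun z => ∫ p in paramBox d, c p * weight h η (z, p) := by
  have hG : ContDiff ℝ ∞ fun q : Point d × ℝ × Jump d => c q.2 * weight h η q :=
    (hc.comp contDiff_snd).mul (contDiff_weight hh.smooth hη.smooth)
  set C : Set (Point d) := traj '' ((tsupport h ×ˢ paramBox d) ∩
    (fun q : Point d × ℝ × Jump d => finish (q.1, q.2.2)) ⁻¹' tsupport η) with hCdef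
  have hCc : IsCompact C := by
    refine IsCompact.image ?_ contDiff_traj.continuous
    refine (IsCompact.prod hh.compact isCompact_paramBox).inter_right
      ((isClosed_tsupport _).preimage ?_)
    exact contDiff_finish.continuous.comp (by fun_prop)
  have hsub : Function.support (fun z => ∫ p in paramBox d, c p * weight h η (z, p)) ⊆ C := by
    intro z hz
    by_contra hzC
    refine hz (setIntegral_eq_zero_of_forall_eq_zero fun p hp => ?_)
    by_contra hne
    obtain ⟨h1, h2, -⟩ := weight_ne_zero hh hη (right_ne_zero_of_mul hne)
    exact hzC ⟨(start (z, p), p), ⟨⟨h1, hp⟩, h2⟩, traj_start z p⟩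
  refine ⟨contDiff_setIntegral_of_contDiff volume isCompact_paramBox hG,
    HasCompactSupport.of_support_subset_isCompact hCc hsub,
    (closure_minimal hsub hCc.isClosed).trans ?_⟩
  rintro _ ⟨q, ⟨⟨h1, h2⟩, h3⟩, rfl⟩
  exact traj_mem (hh.support h1) (hη.support h3) h2.1

lemma fderiv_trajIntegral {h η : Point d → ℝ} (hh : ContDiff ℝ ∞ h)
    (hη : ContDiff ℝ ∞ η) {c : ℝ × Jump d → ℝ} (hc : ContDiff ℝ ∞ c) (z ξ : Point d) :
    fderiv ℝ (fun z => ∫ p in paramBox d, c p * weight h η (z, p)) z ξ =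
      ∫ p in paramBox d, c p * fderiv ℝ (weight h η) (z, p) (ξ, 0) := by
  have hw := contDiff_weight hh hη
  have hG : ContDiff ℝ ∞ fun q : Point d × ℝ × Jump d => c q.2 * weight h η q :=
    (hc.comp contDiff_snd).mul hw
  have hG1 : ContDiff ℝ 1 fun q : Point d × ℝ × Jump d => c q.2 * weight h η q :=
    hG.of_le (by simp)
  rw [(hasFDerivAt_setIntegral_of_contDiff volume isCompact_paramBox hG1 z).fderiv,
    ContinuousLinearMap.integral_apply]
  · refine integral_congr_ae (Filter.Eventually.of_forall fun p => ?_)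
    have h1 : HasFDerivAt (fun q : Point d × ℝ × Jump d => c q.2)
        ((fderiv ℝ c p).comp (ContinuousLinearMap.snd ℝ _ _)) (z, p) :=
      (hc.differentiable (by simp)).differentiableAt.hasFDerivAt.comp (z, p) hasFDerivAt_snd
    have h2 : HasFDerivAt (weight h η) (fderiv ℝ (weight h η) (z, p)) (z, p) :=
      (hw.differentiable (by simp)).differentiableAt.hasFDerivAt
    simp only
    have h3 : fderiv ℝ (fun q : Point d × ℝ × Jump d => c q.2 * weight h η q) (z, p) = _ :=
      (h1.mul h2).fderiv
    rw [h3]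
    simp
  · refine ContinuousOn.integrableOn_compact isCompact_paramBox (Continuous.continuousOn ?_)
    exact ((hG1.continuous_fderiv one_ne_zero).comp (Continuous.prodMk_right z)).clm_comp
      continuous_const

/-! ### Integrals over the trajectory parameters -/

/-- The change of variables from the parameters of a trajectory with one end fixed to its other
end. -/
lemma integral_jump {k : Point d → ℝ} (hk : Continuous k) (hkc : HasCompactSupport k) {κ : ℝ}
    (hκ : κ = 1 ∨ κ = -1) (t : ℝ) (b : ℝ → Vec d → Vec d) (v : Vec d)
    (hint : Integrable fun p : Jump d =>
      p.1 ^ d * k (t + κ * p.1, b p.1 p.2.2 + (κ * p.1) • p.2.1, v + κ • p.2.2))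
    (h0 : ∀ S ≤ 0, ∀ x v, k (t + κ * S, x, v) = 0) :
    ∫ p : Jump d, p.1 ^ d * k (t + κ * p.1, b p.1 p.2.2 + (κ * p.1) • p.2.1, v + κ • p.2.2) =
      ∫ z, k z := by
  have hki : Integrable k := hk.integrable_of_hasCompactSupport hkc
  have hsub : ∀ {X : Type} [NormedAddCommGroup X] [NormedSpace ℝ X] [FiniteDimensional ℝ X]
      [MeasurableSpace X] [BorelSpace X] (μ : Measure X) [μ.IsAddHaarMeasure] (P : X → ℝ) (x : X),
      ∫ y, P (x + κ • y) ∂μ = ∫ y, P y ∂μ := by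
    intro X _ _ _ _ _ μ _ P x
    rcases hκ with rfl | rfl
    · simpa using integral_add_left_eq_self P x
    · simpa [sub_eq_add_neg] using integral_sub_left_eq_self P μ x
  have hslice : ∀ s : ℝ, Integrable fun q : Vec d × Vec d => k (s, q) := fun s =>
    (hk.comp (Continuous.prodMk_right s)).integrable_of_hasCompactSupport
      (hkc.comp_isClosedEmbedding
        ((Topology.IsClosedEmbedding.of_continuous_injective_isClosedMap
          (Continuous.prodMk_right s) (Prod.mk_right_injective s) (isClosedMap_prodMk_left s))))
  rw [Measure.volume_eq_prod] at hint
  rw [Measure.volume_eq_prod, integral_prod _ hint]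
  have key : ∀ᵐ S : ℝ, ∫ q : Vec d × Vec d,
      S ^ d * k (t + κ * S, b S q.2 + (κ * S) • q.1, v + κ • q.2) =
        ∫ q : Vec d × Vec d, k (t + κ • S, q) := by
    filter_upwards [hint.prod_right_ae] with S hS
    rcases le_or_gt S 0 with hS0 | hS0
    · simp [h0 S hS0]
    have hs1 := hslice (t + κ • S)
    rw [Measure.volume_eq_prod] at hS hs1 ⊢
    rw [integral_prod_symm _ hS, integral_prod_symm _ hs1,
      ← hsub volume (fun u => ∫ x, k (t + κ • S, x, u)) v]
    congr 1
    funext w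
    simp only [smul_eq_mul]
    rw [integral_const_mul, Measure.integral_comp_smul volume
      (fun x => k (t + κ * S, b S w + x, v + κ • w)) (κ * S),
      integral_add_left_eq_self (fun x => k (t + κ * S, x, v + κ • w)) (b S w),
      smul_eq_mul, ← mul_assoc]
    have : S ^ d * |((κ * S) ^ Module.finrank ℝ (Vec d))⁻¹| = 1 := by
      have h1 : |κ| = 1 := by rcases hκ with rfl | rfl <;> simp
      rw [finrank_euclideanSpace_fin, abs_inv, abs_pow, abs_mul, h1, one_mul, abs_of_pos hS0]
      exact mul_inv_cancel₀ (pow_pos hS0 d).ne'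
    rw [this, one_mul]
  rw [integral_congr_ae key, hsub volume (fun s : ℝ => ∫ q : Vec d × Vec d, k (s, q)) t]
  rw [Measure.volume_eq_prod] at hki
  exact (integral_prod _ hki).symm

lemma weight_eq_zero {h η : Point d → ℝ} (hh : IsTest (lateBox d) h)
    (hη : IsTest (midBox d) η) (z : Point d) (θ : ℝ) {p : Jump d} (hp : p ∉ jumpBox d) :
    weight h η (z, θ, p) = 0 := by
  by_contra hne
  exact hp (weight_ne_zero hh hη hne).2.2

lemma integrable_weight {h η : Point d → ℝ} (hh : IsTest (lateBox d) h)
    (hη : IsTest (midBox d) η) (z : Point d) (θ : ℝ) :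
    Integrable fun p : Jump d => weight h η (z, θ, p) :=
  ((contDiff_weight hh.smooth hη.smooth).continuous.comp
    ((Continuous.prodMk_right z).comp (Continuous.prodMk_right θ))).integrable_of_hasCompactSupport
      (HasCompactSupport.intro isCompact_jumpBox fun _ hp => weight_eq_zero hh hη z θ hp)

lemma integral_weight_zero {h η : Point d → ℝ} (hh : IsTest (lateBox d) h)
    (hη : IsTest (midBox d) η) (z : Point d) :
    ∫ p : Jump d, weight h η (z, 0, p) = h z * ∫ z, η z := by
  by_cases hz : h z = 0
  · simp [weight, start_zero, hz]
  have hzt : -1 < z.1 := (hh.support (subset_tsupport _ hz)).1.1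
  have hrw : ∀ p : Jump d, weight h η (z, 0, p) = h z * (p.1 ^ d * η (z.1 + -1 * p.1,
      (z.2.1 - p.1 • z.2.2) + (-1 * p.1) • p.2.1, z.2.2 + (-1 : ℝ) • p.2.2)) := by
    intro p
    have : finish (z, p) = (z.1 + -1 * p.1,
        (z.2.1 - p.1 • z.2.2) + (-1 * p.1) • p.2.1, z.2.2 + (-1 : ℝ) • p.2.2) := by
      simp only [finish]
      ext1
      · simp only; ring
      ext1
      · simp only; module
      · simp only; module
    simp only [weight, start_zero, this]
    ring
  have hi := integrable_weight hh hη z 0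
  simp only [hrw] at hi ⊢
  rw [integrable_const_mul_iff (isUnit_iff_ne_zero.2 hz)] at hi
  rw [integral_const_mul, integral_jump (k := η) hη.smooth.continuous hη.compact (Or.inr rfl) z.1
    (fun S _ => z.2.1 - S • z.2.2) z.2.2 hi]
  intro S hS x v
  by_contra hne
  have h1 : z.1 + -1 * S < -(29 / 20) := (hη.support (subset_tsupport _ hne)).1.2
  linarith

lemma integral_weight_one {h η : Point d → ℝ} (hh : IsTest (lateBox d) h)
    (hη : IsTest (midBox d) η) (z : Point d) :
    ∫ p : Jump d, weight h η (z, 1, p) = (∫ z, h z) * η z := by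
  by_cases hz : η z = 0
  · simp [weight, finish_start_one, hz]
  have hzt : z.1 < -(29 / 20) := (hη.support (subset_tsupport _ hz)).1.2
  have hrw : ∀ p : Jump d, weight h η (z, 1, p) = η z * (p.1 ^ d * h (z.1 + 1 * p.1,
      (z.2.1 + p.1 • (z.2.2 + p.2.2)) + (1 * p.1) • p.2.1, z.2.2 + (1 : ℝ) • p.2.2)) := by
    intro p
    simp only [weight, finish_start_one]
    simp only [start_one, one_mul, one_smul]
    ring
  have hi := integrable_weight hh hη z 1
  simp only [hrw] at hi ⊢
  rw [integrable_const_mul_iff (isUnit_iff_ne_zero.2 hz)] at hi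
  rw [integral_const_mul, integral_jump (k := h) hh.smooth.continuous hh.compact (Or.inl rfl) z.1
    (fun S w => z.2.1 + S • (z.2.2 + w)) z.2.2 hi, mul_comm]
  intro S hS x v
  by_contra hne
  have h1 : -1 < z.1 + 1 * S := (hh.support (subset_tsupport _ hne)).1.1
  linarith

lemma continuous_fderiv_weight {h η : Point d → ℝ} (hh : ContDiff ℝ ∞ h)
    (hη : ContDiff ℝ ∞ η) (z : Point d) :
    Continuous fun p : ℝ × Jump d => fderiv ℝ (weight h η) (z, p) :=
  ((contDiff_weight hh hη).continuous_fderiv (by simp)).comp (Continuous.prodMk_right z)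

lemma setIntegral_fderiv_weight_curve {h η : Point d → ℝ} (hh : IsTest (lateBox d) h)
    (hη : IsTest (midBox d) η) (z : Point d) :
    ∫ p in paramBox d, fderiv ℝ (weight h η) (z, p) (0, 1, 0) =
      (∫ z, h z) * η z - h z * ∫ z, η z := by
  have hc : Continuous fun p : ℝ × Jump d => fderiv ℝ (weight h η) (z, p) (0, 1, 0) :=
    (continuous_fderiv_weight hh.smooth hη.smooth z).clm_apply continuous_const
  have hi : IntegrableOn (fun p : ℝ × Jump d => fderiv ℝ (weight h η) (z, p) (0, 1, 0))
      (paramBox d) := hc.continuousOn.integrableOn_compact isCompact_paramBox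
  rw [IntegrableOn, paramBox, Measure.volume_eq_prod, ← Measure.prod_restrict] at hi
  rw [paramBox, Measure.volume_eq_prod, ← Measure.prod_restrict, integral_prod_symm _ hi]
  have hin : ∀ p : Jump d, ∫ θ in Set.Icc (0 : ℝ) 1, fderiv ℝ (weight h η) (z, θ, p) (0, 1, 0) =
      weight h η (z, 1, p) - weight h η (z, 0, p) := by
    intro p
    rw [integral_Icc_eq_integral_Ioc, ← intervalIntegral.integral_of_le zero_le_one]
    refine intervalIntegral.integral_eq_sub_of_hasDerivAt
      (f := fun θ => weight h η (z, θ, p)) (fun θ _ => ?_)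
      ((hc.comp (Continuous.prodMk_left p)).intervalIntegrable 0 1)
    have h1 : HasFDerivAt (weight h η) (fderiv ℝ (weight h η) (z, θ, p)) (z, θ, p) :=
      ((contDiff_weight hh.smooth hη.smooth).differentiable
        (by simp)).differentiableAt.hasFDerivAt
    exact h1.comp_hasDerivAt θ
      ((hasDerivAt_const θ z).prodMk ((hasDerivAt_id θ).prodMk (hasDerivAt_const θ p)))
  simp only [hin]
  rw [setIntegral_eq_integral_of_forall_compl_eq_zero fun p hp => by
      rw [weight_eq_zero hh hη z 1 hp, weight_eq_zero hh hη z 0 hp, sub_zero],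
    integral_sub (integrable_weight hh hη z 1) (integrable_weight hh hη z 0),
    integral_weight_one hh hη, integral_weight_zero hh hη]

lemma setIntegral_fderiv_weight_jump {h η : Point d → ℝ} (hh : IsTest (lateBox d) h)
    (hη : IsTest (midBox d) η) (z : Point d) {c : ℝ → ℝ → ℝ} {ξ : ℝ → Vec d × Vec d}
    (hc : Continuous fun p : ℝ × Jump d => c p.1 p.2.1) (hξ : Continuous ξ) :
    ∫ p in paramBox d, c p.1 p.2.1 * fderiv ℝ (weight h η) (z, p) (0, 0, 0, ξ p.1) = 0 := by
  have hw := contDiff_weight hh.smooth hη.smooth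
  have hcont : Continuous fun p : ℝ × Jump d =>
      c p.1 p.2.1 * fderiv ℝ (weight h η) (z, p) (0, 0, 0, ξ p.1) :=
    hc.mul ((continuous_fderiv_weight hh.smooth hη.smooth z).clm_apply (by fun_prop))
  have hi := hcont.continuousOn.integrableOn_compact (μ := volume) (isCompact_paramBox (d := d))
  rw [paramBox, Measure.volume_eq_prod] at hi ⊢
  rw [setIntegral_prod _ hi]
  refine integral_eq_zero_of_ae (Filter.Eventually.of_forall fun θ => ?_)
  have hi2 := (hcont.comp (Continuous.prodMk_right θ)).continuousOn.integrableOn_compact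
    (μ := volume) (isCompact_jumpBox (d := d))
  rw [jumpBox, Measure.volume_eq_prod] at hi2 ⊢
  simp only [Function.comp_def] at hi2
  simp only
  rw [setIntegral_prod _ hi2]
  refine integral_eq_zero_of_ae (Filter.Eventually.of_forall fun S => ?_)
  simp only [Pi.zero_apply]
  rw [integral_const_mul]
  have hcd : ContDiff ℝ 1 fun q : Vec d × Vec d => weight h η (z, θ, S, q) :=
    (hw.of_le (by simp)).comp (by fun_prop)
  have h0 : ∀ q ∉ (Metric.closedBall 0 4 ×ˢ Metric.closedBall 0 2 : Set (Vec d × Vec d)),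
      weight h η (z, θ, S, q) = 0 := fun q hq =>
    weight_eq_zero hh hη z θ fun hmem => hq hmem.2
  have := setIntegral_fderiv_eq_zero volume
    ((isCompact_closedBall _ _).prod (isCompact_closedBall _ _)) hcd h0 (ξ θ)
  refine mul_eq_zero_of_right _ (Eq.trans ?_ this)
  congr 1
  funext q
  have h1 : HasFDerivAt (weight h η) (fderiv ℝ (weight h η) (z, θ, S, q)) (z, θ, S, q) :=
    (hw.differentiable (by simp)).differentiableAt.hasFDerivAt
  have h2 := h1.comp q ((hasFDerivAt_prodMk_right z (θ, S, q)).comp q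
    ((hasFDerivAt_prodMk_right θ (S, q)).comp q (hasFDerivAt_prodMk_right S q)))
  have h3 : fderiv ℝ (fun q : Vec d × Vec d => weight h η (z, θ, S, q)) q = _ := h2.fderiv
  rw [h3]
  rfl

/-! ### Transport plans -/

lemma setIntegral_paramBox_bound {g : ℝ × Jump d → ℝ} {C : ℝ}
    (hg : ∀ p ∈ paramBox d, ‖g p‖ ≤ C) :
    |∫ p in paramBox d, g p| ≤ C * volume.real (paramBox d) :=
  norm_setIntegral_le_of_norm_le_const isCompact_paramBox.measure_lt_top hg

lemma exists_bound_trajIntegral {η : Point d → ℝ} (hη : IsTest (midBox d) η)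
    {c : ℝ × Jump d → ℝ} (hc : Continuous c) :
    ∃ C, 0 ≤ C ∧ ∀ h : Point d → ℝ, (∀ z, |h z| ≤ 1) → ∀ z,
      |∫ p in paramBox d, c p * weight h η (z, p)| ≤ C := by
  obtain ⟨M, hM⟩ := hη.compact.exists_bound_of_continuous hη.smooth.continuous
  obtain ⟨L, hL⟩ := isCompact_paramBox.exists_bound_of_continuousOn hc.continuousOn
  have hM0 : 0 ≤ M := (norm_nonneg _).trans (hM 0)
  refine ⟨|L| * (2 ^ d * 1 * M) * volume.real (paramBox d), by positivity, fun h hh z =>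
    setIntegral_paramBox_bound fun p hp => ?_⟩
  have hS := hp.2.1
  simp only [weight, norm_mul, norm_pow]
  gcongr
  · exact (hL p hp).trans (le_abs_self L)
  · rw [Real.norm_of_nonneg hS.1]; exact hS.2
  · exact hh _
  · exact hM _

/-- The velocity gradient of the superposed trajectories is bounded in terms of the supremum of
`h` alone. -/
lemma exists_bound_gradV_trajIntegral {η : Point d → ℝ} (hη : IsTest (midBox d) η) :
    ∃ C, 0 ≤ C ∧ ∀ h : Point d → ℝ, IsTest (lateBox d) h → (∀ z, |h z| ≤ 1) → ∀ z e,
      |fderiv ℝ (fun z => ∫ p in paramBox d, (3 * p.2.1 * p.1 ^ 2) * weight h η (z, p)) z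
        (0, 0, e)| ≤ C * ‖e‖ := by
  obtain ⟨M, hM⟩ := (hη.compact.fderiv (𝕜 := ℝ)).exists_bound_of_continuous
    (hη.smooth.continuous_fderiv (by simp))
  have hM0 : 0 ≤ M := (norm_nonneg _).trans (hM 0)
  refine ⟨3 * 2 * (2 ^ d * 1 * (M * 6)) * volume.real (paramBox d), by positivity,
    fun h hh hh1 z e => ?_⟩
  rw [fderiv_trajIntegral hh.smooth hη.smooth (by fun_prop)]
  have hrw : ∀ p : ℝ × Jump d, 3 * p.2.1 * p.1 ^ 2 *
        fderiv ℝ (weight h η) (z, p) ((0, 0, e), 0) =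
      3 * p.2.1 * (p.2.1 ^ d * h (start (z, p)) * fderiv ℝ η (finish (start (z, p), p.2))
          (0, -(3 * (1 - p.1) * p.2.1) • e, (5 - 4 * p.1) • e)) -
        3 * p.2.1 * fderiv ℝ (weight h η) (z, p)
          (0, 0, 0, (3 * (1 - p.1)) • e, -(5 - 4 * p.1) • e) := by
    intro p
    rw [mul_assoc, fderiv_weight_vel hh.smooth hη.smooth z p.1 p.2 e, mul_sub]
  have hc1 : Continuous fun p : ℝ × Jump d => start (z, p) :=
    contDiff_start.continuous.comp (Continuous.prodMk_right z)
  have hc2 : Continuous fun p : ℝ × Jump d => fderiv ℝ η (finish (start (z, p), p.2)) :=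
    (hη.smooth.continuous_fderiv (by simp)).comp
      (contDiff_finish.continuous.comp (hc1.prodMk continuous_snd))
  have hi1 : IntegrableOn (fun p : ℝ × Jump d => 3 * p.2.1 * (p.2.1 ^ d * h (start (z, p)) *
      fderiv ℝ η (finish (start (z, p), p.2))
        (0, -(3 * (1 - p.1) * p.2.1) • e, (5 - 4 * p.1) • e))) (paramBox d) := by
    refine ContinuousOn.integrableOn_compact isCompact_paramBox (Continuous.continuousOn ?_)
    exact (by fun_prop : Continuous fun p : ℝ × Jump d => 3 * p.2.1).mul
      (((by fun_prop : Continuous fun p : ℝ × Jump d => p.2.1 ^ d).mul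
        (hh.smooth.continuous.comp hc1)).mul (hc2.clm_apply (by fun_prop)))
  have hi2 : IntegrableOn (fun p : ℝ × Jump d => 3 * p.2.1 * fderiv ℝ (weight h η) (z, p)
      (0, 0, 0, (3 * (1 - p.1)) • e, -(5 - 4 * p.1) • e)) (paramBox d) := by
    refine ContinuousOn.integrableOn_compact isCompact_paramBox (Continuous.continuousOn ?_)
    exact (by fun_prop : Continuous fun p : ℝ × Jump d => 3 * p.2.1).mul
      ((continuous_fderiv_weight hh.smooth hη.smooth z).clm_apply (by fun_prop))
  simp only [hrw]
  rw [integral_sub hi1 hi2, setIntegral_fderiv_weight_jump hh hη z (c := fun _ S => 3 * S)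
    (ξ := fun θ => ((3 * (1 - θ)) • e, -(5 - 4 * θ) • e)) (by fun_prop) (by fun_prop), sub_zero]
  refine (setIntegral_paramBox_bound (C := 3 * 2 * (2 ^ d * 1 * (M * (6 * ‖e‖))))
    fun p hp => ?_).trans (le_of_eq (by ring))
  have hS := hp.2.1
  have hθ := hp.1
  have hS' : ‖p.2.1‖ ≤ 2 := by rw [Real.norm_of_nonneg hS.1]; exact hS.2
  simp only [norm_mul, norm_pow]
  gcongr
  · norm_num
  · exact hh1 _
  · refine (ContinuousLinearMap.le_opNorm _ _).trans ?_
    gcongr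
    · exact hM _
    · rw [Prod.norm_def, Prod.norm_def]
      simp only [norm_zero, norm_smul]
      refine max_le (by positivity) (max_le ?_ ?_)
      · gcongr
        rw [norm_neg, norm_mul, norm_mul, Real.norm_of_nonneg (sub_nonneg.2 hθ.2),
          Real.norm_of_nonneg hS.1]
        norm_num
        nlinarith [hθ.1, hθ.2, hS.1, hS.2]
      · gcongr
        rw [Real.norm_eq_abs, abs_le]
        constructor <;> linarith [hθ.1, hθ.2]

/-- `φ` is the mass density, and `Ψ` (given by its components) the flux in the velocity variable,
of a transport of mass inside `U`, with the balance equation `𝒯 φ + ∇_v · Ψ = k`; the suprema of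
`φ`, `∇_v φ` and the components of `Ψ` are at most `C`. -/
structure IsTransportPlan (U : Set (Point d)) (C : ℝ) (k φ : Point d → ℝ)
    (Ψ : Fin d → Point d → ℝ) : Prop where
  test : IsTest U φ
  test_flux : ∀ i, IsTest U (Ψ i)
  nonneg : ∀ z, 0 ≤ φ z
  le : ∀ z, φ z ≤ C
  grad_le : ∀ z e, |fderiv ℝ φ z (0, 0, e)| ≤ C * ‖e‖
  flux_le : ∀ i z, |Ψ i z| ≤ C
  balance : ∀ z, transport φ z +
    ∑ i, fderiv ℝ (Ψ i) z (0, 0, EuclideanSpace.single i 1) = k z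

/-- A density `h` on `lateBox` can be transported backwards in time to a multiple of `η`. -/
theorem exists_transportPlan_late {η : Point d → ℝ} (hη : IsTest (midBox d) η)
    (hη0 : ∀ z, 0 ≤ η z) (hη1 : ∫ z, η z = 1) :
    ∃ C, 0 ≤ C ∧ ∀ h : Point d → ℝ, IsTest (lateBox d) h → (∀ z, 0 ≤ h z) → (∀ z, h z ≤ 1) →
      ∃ φ Ψ, IsTransportPlan (lateTube d) C (fun z => (∫ z, h z) * η z - h z) φ Ψ := by
  obtain ⟨C₁, hC₁, H₁⟩ := exists_bound_trajIntegral hη (c := fun p => 3 * p.2.1 * p.1 ^ 2)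
    (by fun_prop)
  obtain ⟨C₂, hC₂, H₂⟩ := exists_bound_gradV_trajIntegral hη
  have hcd : ∀ i : Fin d, ContDiff ℝ ∞ fun p : ℝ × Jump d =>
      -(velShiftDeriv p.1 p.2.2.1 p.2.2.2 i) := by
    intro i
    have : ContDiff ℝ ∞ fun p : ℝ × Jump d => velShiftDeriv p.1 p.2.2.1 p.2.2.2 := by
      unfold velShiftDeriv; fun_prop
    exact ((EuclideanSpace.proj (𝕜 := ℝ) i).contDiff.comp this).neg
  choose C₃ hC₃ H₃ using fun i : Fin d => exists_bound_trajIntegral hη (hcd i).continuous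
  have hsum : 0 ≤ ∑ i, C₃ i := Finset.sum_nonneg fun i _ => hC₃ i
  refine ⟨C₁ + C₂ + ∑ i, C₃ i, by positivity, fun h hh hh0 hh1 => ?_⟩
  have hab : ∀ z, |h z| ≤ 1 := fun z => abs_le.2 ⟨by linarith [hh0 z], hh1 z⟩
  refine ⟨fun z => ∫ p in paramBox d, (3 * p.2.1 * p.1 ^ 2) * weight h η (z, p),
    fun i z => ∫ p in paramBox d, -(velShiftDeriv p.1 p.2.2.1 p.2.2.2 i) * weight h η (z, p),
    isTest_trajIntegral hh hη (by fun_prop), fun i => isTest_trajIntegral hh hη (hcd i),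
    fun z => ?_, fun z => ?_, fun z e => ?_, fun i z => ?_, fun z => ?_⟩
  · refine setIntegral_nonneg isCompact_paramBox.measurableSet fun p hp => ?_
    have hS : 0 ≤ p.2.1 := hp.2.1.1
    have := hh0 (start (z, p))
    have := hη0 (finish (start (z, p), p.2))
    simp only [weight]
    positivity
  · have := (le_abs_self _).trans (H₁ h hab z)
    linarith
  · refine (H₂ h hh hab z e).trans ?_
    gcongr
    linarith
  · have h1 := H₃ i h hab z
    have h2 := Finset.single_le_sum (fun i _ => hC₃ i) (Finset.mem_univ i)
    linarith
  · have hcont := continuous_fderiv_weight hh.smooth hη.smooth z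
    have hi : ∀ {c : ℝ × Jump d → ℝ} (_ : Continuous c) (ξ : Point d), IntegrableOn
        (fun p => c p * fderiv ℝ (weight h η) (z, p) (ξ, 0)) (paramBox d) := fun hc ξ =>
      (hc.mul (hcont.clm_apply continuous_const)).continuousOn.integrableOn_compact
        isCompact_paramBox
    rw [transport, fderiv_trajIntegral hh.smooth hη.smooth (by fun_prop)]
    simp only [fderiv_trajIntegral hh.smooth hη.smooth (hcd _)]
    rw [← integral_finsetSum _ fun i _ => hi (hcd i).continuous _,
      ← integral_add (hi (by fun_prop) _)
        (integrable_finsetSum _ fun i _ => hi (hcd i).continuous _)]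
    have hcurve := setIntegral_fderiv_weight_curve hh hη z
    rw [hη1, mul_one] at hcurve
    rw [← hcurve]
    congr 1
    funext p
    rw [show (z, p) = (z, p.1, p.2) from rfl, fderiv_weight_curve hh.smooth hη.smooth,
      sub_eq_add_neg]
    congr 1
    have hsplit : (((0, 0, velShiftDeriv p.1 p.2.2.1 p.2.2.2), 0) : Point d × ℝ × Jump d) =
        ∑ i, velShiftDeriv p.1 p.2.2.1 p.2.2.2 i •
          (((0, 0, EuclideanSpace.single i 1), 0) : Point d × ℝ × Jump d) := by
      have h1 : velShiftDeriv p.1 p.2.2.1 p.2.2.2 = ∑ i, velShiftDeriv p.1 p.2.2.1 p.2.2.2 i •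
          (EuclideanSpace.single i 1 : Vec d) := by
        simpa using ((EuclideanSpace.basisFun (Fin d) ℝ).sum_repr
          (velShiftDeriv p.1 p.2.2.1 p.2.2.2)).symm
      set L : Vec d →ₗ[ℝ] Point d × ℝ × Jump d :=
        LinearMap.inl ℝ (Point d) (ℝ × Jump d) ∘ₗ LinearMap.inr ℝ ℝ (Vec d × Vec d) ∘ₗ
          LinearMap.inr ℝ (Vec d) (Vec d) with hL
      have h2 := congrArg L h1
      rw [map_sum] at h2
      simp only [map_smul] at h2
      exact h2
    rw [hsplit, map_sum, ← Finset.sum_neg_distrib]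
    refine Finset.sum_congr rfl fun i _ => ?_
    rw [map_smul, smul_eq_mul, neg_mul]

/-- The time reversal that exchanges `lateBox` and `earlyBox`. -/
def reversal (z : Point d) : Point d := (-3 - z.1, z.2.1, -z.2.2)

lemma reversal_reversal (z : Point d) : reversal (reversal z) = z := by
  simp [reversal]

lemma contDiff_reversal : ContDiff ℝ ∞ (reversal (d := d)) := by
  unfold reversal; fun_prop

lemma measurePreserving_reversal : MeasurePreserving (reversal (d := d)) :=
  (Measure.measurePreserving_sub_left volume (-3 : ℝ)).prod
    ((MeasurePreserving.id volume).prod (Measure.measurePreserving_neg volume))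

lemma integral_comp_reversal (h : Point d → ℝ) : ∫ z, h (reversal z) = ∫ z, h z := by
  let e : Point d ≃ᵐ Point d :=
    { toFun := reversal
      invFun := reversal
      left_inv := reversal_reversal
      right_inv := reversal_reversal
      measurable_toFun := contDiff_reversal.continuous.measurable
      measurable_invFun := contDiff_reversal.continuous.measurable }
  exact measurePreserving_reversal.integral_comp e.measurableEmbedding h

lemma IsTest.mono {U V : Set (Point d)} {φ : Point d → ℝ} (hφ : IsTest U φ) (hUV : U ⊆ V) :
    IsTest V φ :=
  ⟨hφ.smooth, hφ.compact, hφ.support.trans hUV⟩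

lemma IsTest.comp_reversal {U V : Set (Point d)} {φ : Point d → ℝ} (hφ : IsTest U φ)
    (hUV : ∀ z ∈ U, reversal z ∈ V) : IsTest V fun z => φ (reversal z) := by
  have hK : IsCompact (reversal '' tsupport φ) := hφ.compact.image contDiff_reversal.continuous
  have hsub : Function.support (fun z => φ (reversal z)) ⊆ reversal '' tsupport φ := fun z hz =>
    ⟨reversal z, subset_tsupport _ hz, reversal_reversal z⟩
  refine ⟨hφ.smooth.comp contDiff_reversal, HasCompactSupport.of_support_subset_isCompact hK hsub,
    (closure_minimal hsub hK.isClosed).trans ?_⟩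
  rintro _ ⟨z, hz, rfl⟩
  exact hUV z (hφ.support hz)

lemma fderiv_comp_reversal {φ : Point d → ℝ} (hφ : ContDiff ℝ ∞ φ) (z ξ : Point d) :
    fderiv ℝ (fun z => φ (reversal z)) z ξ = -fderiv ℝ φ (reversal z) (ξ.1, -ξ.2.1, ξ.2.2) := by
  have h1 : HasFDerivAt φ (fderiv ℝ φ (reversal z)) (reversal z) :=
    (hφ.differentiable (by simp)).differentiableAt.hasFDerivAt
  have h2 : HasFDerivAt reversal _ z :=
    (hasFDerivAt_fst (𝕜 := ℝ) (p := z)).const_sub (-3 : ℝ) |>.prodMk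
      ((hasFDerivAt_snd (𝕜 := ℝ) (p := z)).fst.prodMk (hasFDerivAt_snd (𝕜 := ℝ) (p := z)).snd.neg)
  have h3 : fderiv ℝ (fun z => φ (reversal z)) z = _ := (h1.comp z h2).fderiv
  rw [h3, ← map_neg]
  simp

/-- A density `h` on `earlyBox` can be reached, forwards in time, from a multiple of `η`. -/
theorem exists_transportPlan_early {η : Point d → ℝ} (hη : IsTest (midBox d) η)
    (hη0 : ∀ z, 0 ≤ η z) (hη1 : ∫ z, η z = 1) :
    ∃ C, 0 ≤ C ∧ ∀ h : Point d → ℝ, IsTest (earlyBox d) h → (∀ z, 0 ≤ h z) → (∀ z, h z ≤ 1) →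
      ∃ φ Ψ, IsTransportPlan (openCylinder d 5) C (fun z => h z - (∫ z, h z) * η z) φ Ψ := by
  have hη' : IsTest (midBox d) fun z => η (reversal z) := hη.comp_reversal fun z hz => by
    simp only [midBox, reversal, Set.mem_prod, Set.mem_Ioo, mem_ball_zero_iff, norm_neg] at hz ⊢
    exact ⟨⟨by linarith [hz.1.2], by linarith [hz.1.1]⟩, hz.2⟩
  obtain ⟨C, hC, H⟩ := exists_transportPlan_late hη' (fun z => hη0 _)
    (by rw [integral_comp_reversal, hη1])
  refine ⟨C, hC, fun h hh hh0 hh1 => ?_⟩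
  have hh' : IsTest (lateBox d) fun z => h (reversal z) := hh.comp_reversal fun z hz => by
    simp only [earlyBox, lateBox, reversal, Set.mem_prod, Set.mem_Ioo, mem_ball_zero_iff,
      norm_neg] at hz ⊢
    exact ⟨⟨by linarith [hz.1.2], by linarith [hz.1.1]⟩, hz.2⟩
  have hU : ∀ z ∈ lateTube d, reversal z ∈ openCylinder d 5 := fun z hz => by
    simp only [lateTube, openCylinder, reversal, Set.mem_prod, Set.mem_Ioo, mem_ball_zero_iff,
      norm_neg] at hz ⊢
    exact ⟨⟨by linarith [hz.1.2], by linarith [hz.1.1]⟩, hz.2⟩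
  obtain ⟨φ, Ψ, P⟩ := H _ hh' (fun z => hh0 _) (fun z => hh1 _)
  refine ⟨fun z => φ (reversal z), fun i z => Ψ i (reversal z), P.test.comp_reversal hU,
    fun i => (P.test_flux i).comp_reversal hU, fun z => P.nonneg _, fun z => P.le _,
    fun z e => ?_, fun i z => P.flux_le i _, fun z => ?_⟩
  · rw [fderiv_comp_reversal P.test.smooth, abs_neg]
    simpa using P.grad_le (reversal z) e
  · have hb := P.balance (reversal z)
    rw [integral_comp_reversal, reversal_reversal] at hb
    rw [transport, fderiv_comp_reversal P.test.smooth]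
    simp only [fderiv_comp_reversal (P.test_flux _).smooth, neg_zero, Finset.sum_neg_distrib]
    rw [transport] at hb
    have hR : (reversal z).2.2 = -z.2.2 := rfl
    have hneg : ((1, -z.2.2, 0) : Point d) = (1, (reversal z).2.2, 0) := by rw [hR]
    rw [hneg]
    linarith

/-! ### Weak sub-solutions tested with transport plans -/

lemma inner_gradV {φ : Point d → ℝ} (hφ : ContDiff ℝ ∞ φ) (z : Point d) (e : Vec d) :
    inner ℝ (gradV φ z) e = fderiv ℝ φ z (0, 0, e) := by
  have h1 : HasFDerivAt φ (fderiv ℝ φ z) (z.1, z.2.1, z.2.2) :=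
    (hφ.differentiable (by simp)).differentiableAt.hasFDerivAt
  have h2 := h1.comp z.2.2 ((hasFDerivAt_prodMk_right z.1 (z.2.1, z.2.2)).comp z.2.2
    (hasFDerivAt_prodMk_right z.2.1 z.2.2))
  have h3 : fderiv ℝ (fun w => φ (z.1, z.2.1, w)) z.2.2 = _ := h2.fderiv
  rw [gradV, inner_gradient_left, h3]
  rfl

lemma norm_gradV_le {φ : Point d → ℝ} (hφ : ContDiff ℝ ∞ φ) {C : ℝ} (hC : 0 ≤ C) {z : Point d}
    (h : ∀ e, |fderiv ℝ φ z (0, 0, e)| ≤ C * ‖e‖) : ‖gradV φ z‖ ≤ C := by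
  have h1 := (le_abs_self _).trans (h (gradV φ z))
  rw [← inner_gradV hφ, real_inner_self_eq_norm_sq, sq] at h1
  rcases (norm_nonneg (gradV φ z)).eq_or_lt with h0 | h0
  · rw [← h0]; exact hC
  · exact le_of_mul_le_mul_right h1 h0

lemma continuous_gradV {φ : Point d → ℝ} (hφ : ContDiff ℝ ∞ φ) : Continuous (gradV φ) := by
  have h1 : gradV φ = fun z => (InnerProductSpace.toDual ℝ (Vec d)).symm ((fderiv ℝ φ z).comp
      ((ContinuousLinearMap.inr ℝ ℝ (Vec d × Vec d)).comp
        (ContinuousLinearMap.inr ℝ (Vec d) (Vec d)))) := by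
    funext z
    refine ext_inner_right ℝ fun e => ?_
    rw [inner_gradV hφ, InnerProductSpace.toDual_symm_apply]
    rfl
  rw [h1]
  exact (LinearIsometryEquiv.continuous _).comp
    ((hφ.continuous_fderiv (by simp)).clm_comp continuous_const)

lemma exists_bound_gradV {U : Set (Point d)} {φ : Point d → ℝ} (hφ : IsTest U φ) :
    ∃ M, ∀ z, ‖gradV φ z‖ ≤ M := by
  obtain ⟨M, hM⟩ := (hφ.compact.fderiv (𝕜 := ℝ)).exists_bound_of_continuous
    (hφ.smooth.continuous_fderiv (by simp))
  refine ⟨M, fun z => norm_gradV_le hφ.smooth ((norm_nonneg _).trans (hM z)) fun e => ?_⟩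
  refine ((fderiv ℝ φ z).le_opNorm _).trans ?_
  have he : ‖((0, 0, e) : Point d)‖ = ‖e‖ := by simp [Prod.norm_def]
  rw [he]
  exact mul_le_mul_of_nonneg_right (hM z) (norm_nonneg e)

/-- A symmetric matrix with eigenvalues in `[lam, Lam]` has operator norm at most `Lam`. -/
lemma norm_toEuclideanLin_le {M : Matrix (Fin d) (Fin d) ℝ} (hM : M.IsSymm) {lam Lam : ℝ}
    (hlam : 0 < lam) (hspec : spectrum ℝ M ⊆ Set.Icc lam Lam) (hLam : 0 ≤ Lam) (x : Vec d) :
    ‖Matrix.toEuclideanLin M x‖ ≤ Lam * ‖x‖ := by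
  have hH : M.IsHermitian := by
    rw [Matrix.IsHermitian, Matrix.conjTranspose_eq_transpose_of_trivial]; exact hM
  have hS := Matrix.isSymmetric_toEuclideanLin_iff.mpr hH
  refine le_of_sq_le_sq ?_ (by positivity)
  rw [mul_pow, ← hH.eigenvectorBasis.sum_sq_inner_right,
    ← hH.eigenvectorBasis.sum_sq_inner_right x, Finset.mul_sum]
  refine Finset.sum_le_sum fun i _ => ?_
  have h1 : Matrix.toEuclideanLin M (hH.eigenvectorBasis i) =
      hH.eigenvalues i • hH.eigenvectorBasis i := by
    ext j
    simpa [Matrix.ofLp_toLpLin] using congrFun (hH.mulVec_eigenvectorBasis i) j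
  have h2 := hspec (hH.eigenvalues_mem_spectrum_real i)
  rw [← hS (hH.eigenvectorBasis i) x, h1, real_inner_smul_left, mul_pow]
  gcongr
  · exact hlam.le.trans h2.1
  · exact h2.2

lemma volume_openCylinder_lt_top (r : ℝ) : volume (openCylinder d r) < ⊤ := by
  have : openCylinder d r ⊆
      Set.Icc (-r ^ 2) 0 ×ˢ Metric.closedBall 0 (r ^ 3) ×ˢ Metric.closedBall 0 r :=
    Set.prod_mono Set.Ioo_subset_Icc_self
      (Set.prod_mono Metric.ball_subset_closedBall Metric.ball_subset_closedBall)
  exact (measure_mono this).trans_lt (isCompact_Icc.prod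
    ((isCompact_closedBall _ _).prod (isCompact_closedBall _ _))).measure_lt_top

/-- Integration by parts in one velocity direction. -/
lemma IsWeakGradV.integral_mul_fderiv {U : Set (Point d)} {f : Point d → ℝ}
    {g : Point d → Vec d} (hg : IsWeakGradV U f g) (hf : IntegrableOn f U)
    (hgi : IntegrableOn g U) {ψ : Point d → ℝ} (hψ : IsTest U ψ) (i : Fin d) :
    ∫ z in U, f z * fderiv ℝ ψ z (0, 0, EuclideanSpace.single i 1) =
      -∫ z in U, ψ z * g z i := by
  obtain ⟨M, hM⟩ := exists_bound_gradV hψ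
  obtain ⟨N, hN⟩ := hψ.compact.exists_bound_of_continuous hψ.smooth.continuous
  have h1 : IntegrableOn (fun z => f z • gradV ψ z) U :=
    Integrable.smul_bdd hf M (continuous_gradV hψ.smooth).aestronglyMeasurable
      (Filter.Eventually.of_forall hM)
  have h2 : IntegrableOn (fun z => ψ z • g z) U :=
    Integrable.bdd_smul hgi N hψ.smooth.continuous.aestronglyMeasurable
      (Filter.Eventually.of_forall hN)
  have h3 := congrArg (EuclideanSpace.proj (𝕜 := ℝ) i) (hg.byParts ψ hψ)
  rw [map_neg, ← ContinuousLinearMap.integral_comp_comm _ h1,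
    ← ContinuousLinearMap.integral_comp_comm _ h2] at h3
  have h4 : ∀ z, fderiv ℝ ψ z (0, 0, EuclideanSpace.single i 1) = gradV ψ z i := fun z => by
    rw [← inner_gradV hψ.smooth, EuclideanSpace.inner_single_right]; simp
  simpa [h4] using h3

/-- Testing the equation with a transport plan: a weak sub-solution `f` gains at most a multiple of
`∇_v f` and `S` along it. -/
theorem IsTransportPlan.integral_le {lam Lam : ℝ} (hlam : 0 < lam) (hLam : lam < Lam)
    {A : Point d → Matrix (Fin d) (Fin d) ℝ} {B g : Point d → Vec d} {S f : Point d → ℝ}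
    (hcoef : Coefficients lam Lam (openCylinder d 5) A B S)
    (hf : IsWeakSubsolutionOnCylinder 5 A B S f)
    (hg : IsWeakGradV (openCylinder d 5) f g) (hgi : IntegrableOn g (openCylinder d 5))
    {C : ℝ} (hC : 0 ≤ C) {k φ : Point d → ℝ} {Ψ : Fin d → Point d → ℝ}
    (P : IsTransportPlan (openCylinder d 5) C k φ Ψ) :
    -(∫ z in openCylinder d 5, f z * k z) ≤ C * ((2 * Lam + d) *
      (∫ z in openCylinder d 5, ‖g z‖) + ∫ z in openCylinder d 5, ‖S z‖) := by
  have hLam0 : 0 ≤ Lam := (hlam.trans hLam).le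
  set U := openCylinder d 5 with hU
  have : IsFiniteMeasure (volume.restrict U) := ⟨by
    rw [Measure.restrict_apply_univ]; exact volume_openCylinder_lt_top 5⟩
  have hf2 : MemLp f 2 (volume.restrict U) := hf.sobolev.1
  have hfi : IntegrableOn f U := hf2.integrable (by norm_num)
  have hSi : IntegrableOn S U := hcoef.bounded_S.integrable le_top
  have hgrad : ∀ z, ‖gradV φ z‖ ≤ C := fun z => norm_gradV_le P.test.smooth hC (P.grad_le z)
  have hφabs : ∀ z, ‖φ z‖ ≤ C := fun z => by
    rw [Real.norm_of_nonneg (P.nonneg z)]; exact P.le z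
  -- `β = id` in the definition of a sub-solution
  have hren := hf.renormalized (fun s => s) contDiff_id
    ⟨1, fun s => by simp⟩ g hg φ P.test P.nonneg
  simp only [deriv_id'', mul_one] at hren
  change -(∫ z in U, f z * transport φ z) ≤
    -(∫ z in U, inner ℝ (Matrix.toEuclideanLin (A z) (g z)) (gradV φ z)) +
      ∫ z in U, (inner ℝ (B z) (g z) + S z) * φ z at hren
  have hA : ‖∫ z in U, inner ℝ (Matrix.toEuclideanLin (A z) (g z)) (gradV φ z)‖ ≤
      ∫ z in U, Lam * C * ‖g z‖ := by
    refine norm_integral_le_of_norm_le (hgi.norm.const_mul _) ?_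
    filter_upwards [hcoef.symm_A, hcoef.eigenvalues_A] with z h1 h2
    refine (norm_inner_le_norm _ _).trans ?_
    calc _ ≤ Lam * ‖g z‖ * C := mul_le_mul (norm_toEuclideanLin_le h1 hlam h2 hLam0 _) (hgrad z)
          (norm_nonneg _) (by positivity)
      _ = _ := by ring
  have hB : ‖∫ z in U, (inner ℝ (B z) (g z) + S z) * φ z‖ ≤
      ∫ z in U, (C * Lam * ‖g z‖ + C * ‖S z‖) := by
    refine norm_integral_le_of_norm_le ((hgi.norm.const_mul _).add (hSi.norm.const_mul _)) ?_
    filter_upwards [hcoef.bound_B] with z h1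
    rw [norm_mul]
    calc _ ≤ (Lam * ‖g z‖ + ‖S z‖) * C := by
          refine mul_le_mul ((norm_add_le _ _).trans (add_le_add ?_ le_rfl)) (hφabs z)
            (norm_nonneg _) (by positivity)
          exact (norm_inner_le_norm _ _).trans (by gcongr)
      _ = _ := by ring
  have hΨ : ∀ i, ‖∫ z in U, Ψ i z * g z i‖ ≤ ∫ z in U, C * ‖g z‖ := fun i => by
    refine norm_integral_le_of_norm_le (hgi.norm.const_mul _) (Filter.Eventually.of_forall ?_)
    intro z
    rw [norm_mul]
    exact mul_le_mul (P.flux_le i z) (PiLp.norm_apply_le _ _) (norm_nonneg _) hC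
  have hbdd : ∀ {ψ : Point d → ℝ} (_ : IsTest U ψ) (b : Point d → Point d) (_ : Continuous b),
      IntegrableOn (fun z => f z * fderiv ℝ ψ z (b z)) U := by
    intro ψ hψ b hb
    have hc : Continuous fun z => fderiv ℝ ψ z (b z) :=
      (hψ.smooth.continuous_fderiv (by simp)).clm_apply hb
    have hcs : HasCompactSupport fun z => fderiv ℝ ψ z (b z) :=
      (hψ.compact.fderiv (𝕜 := ℝ)).mono fun z hz h0 => hz (by simp [h0])
    obtain ⟨M, hM⟩ := hcs.exists_bound_of_continuous hc
    exact hfi.mul_bdd hc.aestronglyMeasurable (Filter.Eventually.of_forall hM)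
  have hT : IntegrableOn (fun z => f z * transport φ z) U :=
    hbdd P.test (fun z => (1, z.2.2, 0)) (by fun_prop)
  have hk : ∫ z in U, f z * k z = (∫ z in U, f z * transport φ z) -
      ∑ i, ∫ z in U, Ψ i z * g z i := by
    have h1 : ∀ z, f z * k z = f z * transport φ z +
        ∑ i, f z * fderiv ℝ (Ψ i) z (0, 0, EuclideanSpace.single i 1) := fun z => by
      rw [← P.balance z, mul_add, Finset.mul_sum]
    simp only [h1]
    rw [integral_add hT
      (integrable_finsetSum _ fun i _ => hbdd (P.test_flux i) _ continuous_const),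
      integral_finsetSum _ fun i _ => hbdd (P.test_flux i) _ continuous_const, sub_eq_add_neg,
      ← Finset.sum_neg_distrib]
    congr 1
    exact Finset.sum_congr rfl fun i _ => hg.integral_mul_fderiv hfi hgi (P.test_flux i) i
  have hsum : ∑ i, ∫ z in U, Ψ i z * g z i ≤ d * (C * ∫ z in U, ‖g z‖) := by
    refine (Finset.sum_le_sum fun i _ => (le_abs_self _).trans (hΨ i)).trans (le_of_eq ?_)
    simp [integral_const_mul]
  rw [integral_add (hgi.norm.const_mul _) (hSi.norm.const_mul _), integral_const_mul,
    integral_const_mul] at hB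
  rw [integral_const_mul] at hA
  have hA' := (abs_le.1 hA).1
  have hB' := (abs_le.1 hB).2
  rw [hk]
  nlinarith

/-! ### Approximation by test functions -/

/-- Indicator functions of subsets of `O` are limits of test functions with values in `[0, 1]`. -/
lemma exists_test_approx {O U : Set (Point d)} (hO : IsOpen O) (hOU : O ⊆ U)
    {f : Point d → ℝ} (hf : IntegrableOn f U) {E : Set (Point d)} (hE : MeasurableSet E)
    (hEO : E ⊆ O) (hEv : volume E ≠ ⊤) {ε : ℝ} (hε : 0 < ε) :
    ∃ h : Point d → ℝ, IsTest O h ∧ (∀ z, 0 ≤ h z) ∧ (∀ z, h z ≤ 1) ∧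
      |(∫ z in U, f z * h z) - ∫ z in E, f z| ≤ ε ∧ |(∫ z, h z) - volume.real E| ≤ ε := by
  obtain ⟨δ, hδ, hδf⟩ := exists_pos_setLIntegral_lt_of_measure_lt (μ := volume.restrict U)
    (f := fun z => ‖f z‖ₑ) hf.hasFiniteIntegral.ne (ENNReal.ofReal_pos.2 hε).ne'
  set δ' : ENNReal := min δ (ENNReal.ofReal ε) / 2 with hδ'
  have hδ'0 : δ' ≠ 0 := by
    simp [hδ', hδ.ne', hε]
  obtain ⟨K, hKE, hK, hKv⟩ := hE.exists_isCompact_sdiff_lt hEv hδ'0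
  obtain ⟨V, hEV, hV, -, hVv⟩ := hE.exists_isOpen_sdiff_lt hEv hδ'0
  obtain ⟨L, hL, hKL, hLV⟩ := exists_compact_between hK (hV.inter hO)
    (hKE.trans (Set.subset_inter hEV hEO))
  obtain ⟨h, h1, h0, h01⟩ := exists_contMDiffMap_one_nhds_of_subset_interior
    (n := ⊤) (modelWithCornersSelf ℝ (Point d)) hK.isClosed hKL
  have hsm : ContDiff ℝ ∞ h := h.contMDiff.contDiff
  have hsupp : Function.support h ⊆ L := fun z hz => by
    by_contra hzL
    exact hz (h0 z hzL)
  have hcs : HasCompactSupport h := HasCompactSupport.of_support_subset_isCompact hL hsupp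
  have hLO : L ⊆ O := hLV.trans Set.inter_subset_right
  have hEU : E ⊆ U := hEO.trans hOU
  set s : Set (Point d) := (V ∩ O) \ K with hs
  have hsm' : MeasurableSet s := (hV.inter hO).measurableSet.diff hK.measurableSet
  have hsU : s ⊆ U := fun z hz => hOU hz.1.2
  have hsv : volume s < min δ (ENNReal.ofReal ε) := by
    have hsub : s ⊆ (V \ E) ∪ (E \ K) := fun z hz => by
      by_cases hzE : z ∈ E
      · exact Or.inr ⟨hzE, hz.2⟩
      · exact Or.inl ⟨hz.1.1, hzE⟩
    refine (measure_mono hsub).trans_lt ((measure_union_le _ _).trans_lt ?_)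
    rw [← ENNReal.add_halves (min δ (ENNReal.ofReal ε))]
    exact ENNReal.add_lt_add hVv hKv
  -- `h` and the indicator function of `E` agree outside the small set `s`
  have hdiff : ∀ z, |h z - E.indicator 1 z| ≤ s.indicator 1 z := by
    intro z
    by_cases hzs : z ∈ s
    · rw [Set.indicator_of_mem hzs, abs_le]
      by_cases hzE : z ∈ E
      · rw [Set.indicator_of_mem hzE]
        simp only [Pi.one_apply]
        constructor <;> linarith [(h01 z).1, (h01 z).2]
      · rw [Set.indicator_of_notMem hzE]
        simp only [Pi.one_apply]
        constructor <;> linarith [(h01 z).1, (h01 z).2]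
    · by_cases hzK : z ∈ K
      · rw [Set.indicator_of_mem (hKE hzK), h1.self_of_nhdsSet z hzK]
        simp [hzs]
      · have hzV : z ∉ V ∩ O := fun hz => hzs ⟨hz, hzK⟩
        rw [h0 z fun hzL => hzV (hLV hzL),
          Set.indicator_of_notMem fun hzE => hzV ⟨hEV hzE, hEO hzE⟩]
        simp [hzs]
  have hEi : Integrable (E.indicator (1 : Point d → ℝ)) :=
    (integrable_indicator_iff hE).2 (integrableOn_const hEv)
  have hsv' : volume s ≠ ⊤ := (hsv.trans_le (min_le_right _ _)).ne_top
  refine ⟨h, ⟨hsm, hcs, (closure_minimal hsupp hL.isClosed).trans hLO⟩, fun z => (h01 z).1,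
    fun z => (h01 z).2, ?_, ?_⟩
  · have e1 : ∫ z in E, f z = ∫ z in U, f z * E.indicator 1 z := by
      rw [← integral_indicator hE]
      rw [← setIntegral_eq_integral_of_forall_compl_eq_zero (s := U) fun z hz => by
        rw [Set.indicator_of_notMem fun hzE => hz (hEU hzE)]]
      congr 1
      funext z
      by_cases hz : z ∈ E <;> simp [hz]
    have i1 : IntegrableOn (fun z => f z * h z) U :=
      hf.mul_bdd (c := 1) hsm.continuous.aestronglyMeasurable
        (Filter.Eventually.of_forall fun z => by
          rw [Real.norm_of_nonneg (h01 z).1]; exact (h01 z).2)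
    have i2 : IntegrableOn (fun z => f z * E.indicator 1 z) U :=
      hf.mul_bdd (c := 1) (aestronglyMeasurable_one.indicator hE)
        (Filter.Eventually.of_forall fun z => by by_cases hz : z ∈ E <;> simp [hz])
    rw [e1, ← integral_sub i1 i2]
    have hfs : IntegrableOn (fun z => ‖f z‖) s := (hf.mono_set hsU).norm
    have hsi : ∫ z in U, s.indicator (fun z => ‖f z‖) z = ∫ z in s, ‖f z‖ := by
      rw [setIntegral_indicator hsm', Set.inter_eq_right.2 hsU]
    have h2 : ∫ z in s, ‖f z‖ ≤ ε := by
      rw [integral_norm_eq_lintegral_enorm (hf.mono_set hsU).aestronglyMeasurable]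
      refine ENNReal.toReal_le_of_le_ofReal hε.le (le_of_lt ?_)
      have := hδf s (by
        rw [Measure.restrict_apply hsm', Set.inter_eq_left.2 hsU]
        exact hsv.trans_le (min_le_left _ _))
      rwa [Measure.restrict_restrict hsm', Set.inter_eq_left.2 hsU] at this
    refine le_trans ?_ h2
    rw [← hsi]
    rw [← Real.norm_eq_abs]
    refine norm_integral_le_of_norm_le ?_ (Filter.Eventually.of_forall fun z => ?_)
    · exact hf.norm.indicator hsm'
    · rw [← mul_sub, norm_mul]
      refine (mul_le_mul_of_nonneg_left (hdiff z) (norm_nonneg _)).trans (le_of_eq ?_)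
      by_cases hz : z ∈ s <;> simp [hz]
  · have e1 : volume.real E = ∫ z, E.indicator (1 : Point d → ℝ) z := by
      rw [integral_indicator_one hE]
    rw [e1, ← integral_sub (hsm.continuous.integrable_of_hasCompactSupport hcs) hEi]
    have h2 : volume.real s ≤ ε :=
      ENNReal.toReal_le_of_le_ofReal hε.le (hsv.le.trans (min_le_right _ _))
    refine le_trans ?_ h2
    rw [← integral_indicator_one hsm', ← Real.norm_eq_abs]
    exact norm_integral_le_of_norm_le
      ((integrable_indicator_iff (f := (1 : Point d → ℝ)) hsm').2 (integrableOn_const hsv'))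
      (Filter.Eventually.of_forall hdiff)

/-- There is a smooth probability density on `midBox`. -/
lemma exists_density_midBox : ∃ η : Point d → ℝ, IsTest (midBox d) η ∧ (∀ z, 0 ≤ η z) ∧
    ∫ z, η z = 1 := by
  let b : ContDiffBump ((-(3 / 2), 0, 0) : Point d) := ⟨1 / 80, 1 / 40, by norm_num, by norm_num⟩
  refine ⟨b.normed volume, ⟨b.contDiff_normed, b.hasCompactSupport_normed, ?_⟩,
    b.nonneg_normed, b.integral_normed⟩
  rw [b.tsupport_normed_eq]
  intro z hz
  rw [mem_closedBall_iff_norm] at hz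
  have h1 := (norm_fst_le _).trans hz
  have h2 := (norm_fst_le _).trans ((norm_snd_le _).trans hz)
  have h3 := (norm_snd_le _).trans ((norm_snd_le _).trans hz)
  simp only [Prod.fst_sub, Prod.snd_sub, sub_zero, Real.norm_eq_abs, abs_le, b] at h1 h2 h3
  simp only [midBox, Set.mem_prod, Set.mem_Ioo, mem_ball_zero_iff]
  exact ⟨⟨by linarith, by linarith⟩, by linarith, by linarith⟩

/-! ### The Poincaré inequality -/

lemma cylinder_ae_eq (t₀ : ℝ) : cylinder 1 ((t₀, 0, 0) : Point d) =ᵐ[volume]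
    (Set.Ioo (t₀ - 1) t₀ ×ˢ Metric.ball 0 1 ×ˢ Metric.ball 0 1 : Set (Point d)) := by
  have h1 : cylinder 1 ((t₀, 0, 0) : Point d) =
      Set.Ioc (t₀ - 1) t₀ ×ˢ Metric.ball 0 1 ×ˢ Metric.ball 0 1 := by
    ext z
    simp only [cylinder, Set.mem_ofPred_eq, Set.mem_prod, Set.mem_Ioc, mem_ball_zero_iff, sub_zero,
      smul_zero, one_pow]
    constructor
    · rintro ⟨a, b, c, e⟩; exact ⟨⟨by linarith, by linarith⟩, c, e⟩
    · rintro ⟨⟨a, b⟩, c, e⟩; exact ⟨by linarith, by linarith, c, e⟩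
  rw [h1, Measure.volume_eq_prod]
  exact Measure.set_prod_ae_eq Ioo_ae_eq_Ioc.symm (Filter.EventuallyEq.refl _ _)

lemma openCylinder_subset_cylinder (r : ℝ) :
    openCylinder d r ⊆ cylinder r ((0, 0, 0) : Point d) := by
  intro z hz
  simp only [openCylinder, Set.mem_prod, Set.mem_Ioo, mem_ball_zero_iff] at hz
  simp only [cylinder, Set.mem_ofPred_eq, sub_zero, smul_zero]
  exact ⟨hz.1.1, hz.1.2.le, hz.2⟩

lemma lateBox_subset : lateBox d ⊆ openCylinder d 5 :=
  Set.prod_mono (Set.Ioo_subset_Ioo (by norm_num) le_rfl)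
    (Set.prod_mono (Metric.ball_subset_ball (by norm_num)) (Metric.ball_subset_ball (by norm_num)))

lemma earlyBox_subset : earlyBox d ⊆ openCylinder d 5 :=
  Set.prod_mono (Set.Ioo_subset_Ioo (by norm_num) (by norm_num))
    (Set.prod_mono (Metric.ball_subset_ball (by norm_num)) (Metric.ball_subset_ball (by norm_num)))

lemma lateTube_subset : lateTube d ⊆ openCylinder d 5 :=
  Set.prod_mono (Set.Ioo_subset_Ioo (by norm_num) le_rfl) subset_rfl

lemma IsTransportPlan.mono {U V : Set (Point d)} {C C' : ℝ} {k φ : Point d → ℝ}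
    {Ψ : Fin d → Point d → ℝ} (P : IsTransportPlan U C k φ Ψ) (hUV : U ⊆ V) (hC : C ≤ C') :
    IsTransportPlan V C' k φ Ψ where
  test := P.test.mono hUV
  test_flux i := (P.test_flux i).mono hUV
  nonneg := P.nonneg
  le z := (P.le z).trans hC
  grad_le z e := (P.grad_le z e).trans (by gcongr)
  flux_le i z := (P.flux_le i z).trans hC
  balance := P.balance

/-- An estimate for all test functions `h` on `O` with values in `[0, 1]` extends to indicator
functions. -/
lemma setIntegral_le_of_forall_test {O U : Set (Point d)} (hO : IsOpen O) (hOU : O ⊆ U)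
    {f : Point d → ℝ} (hf : IntegrableOn f U) {a b D : ℝ}
    (H : ∀ h : Point d → ℝ, IsTest O h → (∀ z, 0 ≤ h z) → (∀ z, h z ≤ 1) →
      a * (∫ z in U, f z * h z) ≤ b * (∫ z, h z) + D)
    {E : Set (Point d)} (hE : MeasurableSet E) (hEO : E ⊆ O) (hEv : volume E ≠ ⊤) :
    a * (∫ z in E, f z) ≤ b * volume.real E + D := by
  refine le_of_forall_pos_le_add fun ε hε => ?_
  have hpos : 0 < |a| + |b| + 1 := by positivity
  obtain ⟨h, hh, h0, h1, e1, e2⟩ := exists_test_approx hO hOU hf hE hEO hEv (div_pos hε hpos)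
  have h2 := H h hh h0 h1
  have h3 : a * (∫ z in E, f z) - a * (∫ z in U, f z * h z) ≤ |a| * (ε / (|a| + |b| + 1)) := by
    rw [← mul_sub]
    refine (le_abs_self _).trans ?_
    rw [abs_mul, abs_sub_comm]
    gcongr
  have h4 : b * (∫ z, h z) - b * volume.real E ≤ |b| * (ε / (|a| + |b| + 1)) := by
    rw [← mul_sub]
    refine (le_abs_self _).trans ?_
    rw [abs_mul]
    gcongr
  have h5 : |a| * (ε / (|a| + |b| + 1)) + |b| * (ε / (|a| + |b| + 1)) ≤ ε := by
    rw [← add_mul, mul_div_assoc', div_le_iff₀ hpos]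
    nlinarith
  linarith

lemma volume_earlyBox_pos : 0 < volume.real (earlyBox d) := by
  refine ENNReal.toReal_pos (isOpen_earlyBox.measure_pos volume ?_).ne'
    ((measure_mono earlyBox_subset).trans_lt (volume_openCylinder_lt_top 5)).ne
  exact ⟨(-(5 / 2), 0, 0), by norm_num [earlyBox]⟩

/-- The Poincaré inequality in terms of real integrals, without the term that contains `f`. -/
theorem exists_integral_pos_part_le (d : ℕ) {lam Lam : ℝ} (hlam : 0 < lam) (hLam : lam < Lam) :
    ∃ C : ℝ, 0 < C ∧ ∀ (A : Point d → Matrix (Fin d) (Fin d) ℝ) (B : Point d → Vec d)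
      (S f : Point d → ℝ) (g : Point d → Vec d),
      Coefficients lam Lam (openCylinder d 5) A B S → IsWeakSubsolutionOnCylinder 5 A B S f →
      IsWeakGradV (openCylinder d 5) f g → IntegrableOn g (openCylinder d 5) →
      ∫ z in lateBox d, max (f z - ⨍ w in earlyBox d, f w) 0 ≤
        C * ((∫ z in openCylinder d 5, ‖g z‖) + ∫ z in openCylinder d 5, ‖S z‖) := by
  obtain ⟨η, hη, hη0, hη1⟩ := exists_density_midBox (d := d)
  obtain ⟨C₁, hC₁, H₁⟩ := exists_transportPlan_late hη hη0 hη1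
  obtain ⟨C₂, hC₂, H₂⟩ := exists_transportPlan_early hη hη0 hη1
  have hLam0 : 0 < Lam := hlam.trans hLam
  set V₀ := volume.real (earlyBox d)
  set V₁ := volume.real (lateBox d)
  have hV₀ : 0 < V₀ := volume_earlyBox_pos
  have hV₁ : 0 ≤ V₁ := measureReal_nonneg
  refine ⟨(V₁ / V₀ + 1) * ((C₁ + C₂ + 1) * (2 * Lam + d + 1)), by positivity,
    fun A B S f g hcoef hf hg hgi => ?_⟩
  set U := openCylinder d 5 with hU
  have : IsFiniteMeasure (volume.restrict U) := ⟨by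
    rw [Measure.restrict_apply_univ]; exact volume_openCylinder_lt_top 5⟩
  have hf2 : MemLp f 2 (volume.restrict U) := hf.sobolev.1
  have hfi : IntegrableOn f U := hf2.integrable (by norm_num)
  set a := ∫ z in U, ‖g z‖
  set b := ∫ z in U, ‖S z‖
  have ha : 0 ≤ a := integral_nonneg fun _ => norm_nonneg _
  have hb : 0 ≤ b := integral_nonneg fun _ => norm_nonneg _
  set D := (C₁ + C₂ + 1) * ((2 * Lam + d) * a + b) with hD
  have hD0 : 0 ≤ D := by positivity
  have hOv : ∀ {O : Set (Point d)}, O ⊆ U → volume O ≠ ⊤ := fun hO =>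
    ((measure_mono hO).trans_lt (volume_openCylinder_lt_top 5)).ne
  set I := ∫ z in U, f z * η z with hI
  have hfη : ∀ {ψ : Point d → ℝ} {O : Set (Point d)}, IsTest O ψ →
      IntegrableOn (fun z => f z * ψ z) U := fun hψ => by
    obtain ⟨M, hM⟩ := hψ.compact.exists_bound_of_continuous hψ.smooth.continuous
    exact hfi.mul_bdd hψ.smooth.continuous.aestronglyMeasurable (Filter.Eventually.of_forall hM)
  have hlate : ∀ E, MeasurableSet E → E ⊆ lateBox d →
      1 * (∫ z in E, f z) ≤ I * volume.real E + D := fun E hE hEO => by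
    refine setIntegral_le_of_forall_test isOpen_lateBox lateBox_subset hfi
      (fun h hh h0 h1 => ?_) hE hEO (hOv (hEO.trans lateBox_subset))
    obtain ⟨φ, Ψ, P⟩ := H₁ h hh h0 h1
    have := (P.mono lateTube_subset (C' := C₁ + C₂ + 1) (by linarith)).integral_le hlam hLam hcoef
      hf hg hgi (by positivity)
    have e1 : ∫ z in U, f z * ((∫ z, h z) * η z - h z) =
        (∫ z, h z) * I - ∫ z in U, f z * h z := by
      rw [hI, ← integral_const_mul, ← integral_sub ((hfη hη).const_mul _) (hfη hh)]
      congr 1; funext z; ring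
    rw [e1] at this
    linarith
  have hearly : -1 * (∫ z in earlyBox d, f z) ≤ -I * V₀ + D := by
    refine setIntegral_le_of_forall_test isOpen_earlyBox earlyBox_subset hfi
      (fun h hh h0 h1 => ?_) isOpen_earlyBox.measurableSet subset_rfl (hOv earlyBox_subset)
    obtain ⟨φ, Ψ, P⟩ := H₂ h hh h0 h1
    have := (P.mono subset_rfl (C' := C₁ + C₂ + 1) (by linarith)).integral_le hlam hLam hcoef
      hf hg hgi (by positivity)
    have e1 : ∫ z in U, f z * (h z - (∫ z, h z) * η z) =
        (∫ z in U, f z * h z) - (∫ z, h z) * I := by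
      rw [hI, ← integral_const_mul, ← integral_sub (hfη hh) ((hfη hη).const_mul _)]
      congr 1; funext z; ring
    rw [e1] at this
    linarith
  set m := ⨍ w in earlyBox d, f w with hm
  have hmI : ∫ z in earlyBox d, f z = m * V₀ := by
    rw [hm, setAverage_eq, smul_eq_mul]
    change _ = V₀⁻¹ * _ * V₀
    rw [mul_comm V₀⁻¹, mul_assoc, inv_mul_cancel₀ hV₀.ne', mul_one]
  have hIm : I ≤ m + D / V₀ := by
    rw [hmI] at hearly
    rw [← sub_le_iff_le_add', le_div_iff₀ hV₀]
    linarith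
  -- the positive part is tested with the indicator function of the set where `f > m`
  obtain ⟨f', hf'm, hff'⟩ := hfi.aestronglyMeasurable
  set E := lateBox d ∩ {z | m < f' z} with hEdef
  have hE : MeasurableSet E := isOpen_lateBox.measurableSet.inter
    (measurableSet_lt measurable_const hf'm.measurable)
  have hEO : E ⊆ lateBox d := Set.inter_subset_left
  have hEU : E ⊆ U := hEO.trans lateBox_subset
  have hEle : volume.real E ≤ V₁ := measureReal_mono hEO (hOv lateBox_subset)
  have hpos : ∫ z in lateBox d, max (f z - m) 0 = (∫ z in E, f z) - m * volume.real E := by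
    have h1 : ∫ z in lateBox d, max (f z - m) 0 =
        ∫ z in lateBox d, E.indicator (fun z => f z - m) z := by
      refine setIntegral_congr_ae isOpen_lateBox.measurableSet ?_
      have h2 := (ae_restrict_iff' (isOpen_openCylinder 5).measurableSet).1 hff'
      filter_upwards [h2] with z hz hzO
      have hz' := hz (lateBox_subset hzO)
      by_cases hzm : m < f' z
      · rw [Set.indicator_of_mem (show z ∈ E from ⟨hzO, hzm⟩), max_eq_left]
        rw [hz']; linarith
      · rw [Set.indicator_of_notMem (fun hzE : z ∈ E => hzm hzE.2), max_eq_right]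
        rw [hz']; linarith
    rw [h1, setIntegral_indicator hE, Set.inter_eq_right.2 hEO,
      integral_sub (hfi.mono_set hEU) (integrableOn_const (hOv hEU)), setIntegral_const,
      smul_eq_mul, mul_comm m]
  have h1 := hlate E hE hEO
  rw [one_mul] at h1
  have h2 : I * volume.real E ≤ m * volume.real E + D / V₀ * V₁ := by
    have h3 := mul_le_mul_of_nonneg_right hIm (measureReal_nonneg (μ := volume) (s := E))
    have h4 := mul_le_mul_of_nonneg_left hEle (div_nonneg hD0 hV₀.le)
    linarith
  have h5 : D ≤ (C₁ + C₂ + 1) * (2 * Lam + d + 1) * (a + b) := by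
    rw [hD, mul_assoc]
    have : 0 ≤ 2 * Lam + d := by positivity
    gcongr
    nlinarith
  calc ∫ z in lateBox d, max (f z - m) 0 ≤ (V₁ / V₀ + 1) * D := by
        rw [hpos, show (V₁ / V₀ + 1) * D = D / V₀ * V₁ + D by ring]
        linarith
    _ ≤ (V₁ / V₀ + 1) * ((C₁ + C₂ + 1) * (2 * Lam + d + 1) * (a + b)) := by gcongr
    _ = _ := by ring

end Kinetic

theorem proposition3p1 (d : ℕ) (hd : 1 ≤ d) (lam Lam : ℝ) (hlam : 0 < lam) (hLam : lam < Lam) :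
    ∃ C : ℝ, 0 < C ∧
      ∀ (ε σ : ℝ), 0 < ε → ε < 1 → 0 < σ → σ < 1 / 3 →
      ∀ (A : Kinetic.Point d → Matrix (Fin d) (Fin d) ℝ)
        (B : Kinetic.Point d → EuclideanSpace ℝ (Fin d))
        (S f : Kinetic.Point d → ℝ) (gradf : Kinetic.Point d → EuclideanSpace ℝ (Fin d)),
        Kinetic.Coefficients lam Lam (Kinetic.openCylinder d 5) A B S →
        Kinetic.IsWeakSubsolutionOnCylinder 5 A B S f →
        (∀ᵐ z ∂volume.restrict (Kinetic.openCylinder d 5), 0 ≤ f z) →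
        Kinetic.IsWeakGradV (Kinetic.openCylinder d 5) f gradf →
        eLpNorm (fun z => max (f z - ⨍ w in Kinetic.cylinder 1 (-2, 0, 0), f w) 0) 1
            (volume.restrict (Kinetic.cylinder 1 (0, 0, 0))) ≤
          ENNReal.ofReal C *
            (ENNReal.ofReal (1 / ε ^ (d + 2)) *
                eLpNorm gradf 1 (volume.restrict (Kinetic.cylinder 5 (0, 0, 0))) +
              ENNReal.ofReal (ε ^ σ * (1 / 3 - σ)⁻¹) *
                eLpNorm f 2 (volume.restrict (Kinetic.cylinder 5 (0, 0, 0))) +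
              eLpNorm S 2 (volume.restrict (Kinetic.cylinder 5 (0, 0, 0)))) := by
  obtain ⟨C, hC, H⟩ := Kinetic.exists_integral_pos_part_le d hlam hLam
  set U := Kinetic.openCylinder d 5 with hU
  have hUfin : volume U < ⊤ := Kinetic.volume_openCylinder_lt_top 5
  set e : ℝ := 1 / (1 : ENNReal).toReal - 1 / (2 : ENNReal).toReal with he
  have he0 : 0 ≤ e := by rw [he]; norm_num
  -- the factor from Hölder's inequality for `S`
  set M : ℝ := (volume U ^ e).toReal with hM
  have hMfin : volume U ^ e ≠ ⊤ := ENNReal.rpow_ne_top_of_nonneg he0 hUfin.ne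
  have hM0 : 0 ≤ M := ENNReal.toReal_nonneg
  refine ⟨C * (1 + M), by positivity, ?_⟩
  intro ε σ hε hε1 _ _ A B S f g hcoef hf _ hg
  have hεd : (1 : ENNReal) ≤ ENNReal.ofReal (1 / ε ^ (d + 2)) := by
    rw [ENNReal.one_le_ofReal]
    exact (one_le_div (by positivity)).2 (pow_le_one₀ hε.le hε1.le)
  have hsub : volume.restrict U ≤ volume.restrict (Kinetic.cylinder 5 (0, 0, 0)) :=
    Measure.restrict_mono (Kinetic.openCylinder_subset_cylinder 5) le_rfl
  set a := eLpNorm g 1 (volume.restrict (Kinetic.cylinder 5 (0, 0, 0))) with ha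
  set b := eLpNorm S 2 (volume.restrict (Kinetic.cylinder 5 (0, 0, 0))) with hb
  suffices hmain : eLpNorm (fun z => max (f z - ⨍ w in Kinetic.cylinder 1 (-2, 0, 0), f w) 0) 1
      (volume.restrict (Kinetic.cylinder 1 (0, 0, 0))) ≤ ENNReal.ofReal (C * (1 + M)) * (a + b) by
    refine hmain.trans ?_
    gcongr
    exact (le_mul_of_one_le_left zero_le hεd).trans le_self_add
  by_cases haT : a = ⊤
  · rw [haT, top_add, ENNReal.mul_top (ENNReal.ofReal_pos.2 (by positivity)).ne']
    exact le_top
  have haU : eLpNorm g 1 (volume.restrict U) ≤ a := eLpNorm_mono_measure g hsub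
  have hgi : IntegrableOn g U := memLp_one_iff_integrable.1
    ⟨hg.locInt_grad.aestronglyMeasurable, haU.trans_lt (lt_top_iff_ne_top.2 haT)⟩
  have : IsFiniteMeasure (volume.restrict U) := ⟨by rwa [Measure.restrict_apply_univ]⟩
  have hSi : IntegrableOn S U := hcoef.bounded_S.integrable le_top
  have hf2 : MemLp f 2 (volume.restrict U) := hf.sobolev.1
  have hfi : IntegrableOn f U := hf2.integrable (by norm_num)
  have hkey := H A B S f g hcoef hf hg hgi
  have hae1 : Kinetic.cylinder 1 ((0, 0, 0) : Kinetic.Point d) =ᵐ[volume] Kinetic.lateBox d := by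
    have := Kinetic.cylinder_ae_eq (d := d) 0
    rwa [zero_sub] at this
  have hae0 : Kinetic.cylinder 1 ((-2, 0, 0) : Kinetic.Point d) =ᵐ[volume]
      Kinetic.earlyBox d := by
    have := Kinetic.cylinder_ae_eq (d := d) (-2)
    rwa [show (-2 - 1 : ℝ) = -3 by norm_num] at this
  rw [Measure.restrict_congr_set hae1, setAverage_congr hae0]
  set m := ⨍ w in Kinetic.earlyBox d, f w
  have hlU := Kinetic.lateBox_subset (d := d)
  have hmi : IntegrableOn (fun z => max (f z - m) 0) (Kinetic.lateBox d) :=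
    ((hfi.mono_set hlU).sub
      (integrableOn_const ((measure_mono hlU).trans_lt hUfin).ne)).pos_part
  have hL : eLpNorm (fun z => max (f z - m) 0) 1 (volume.restrict (Kinetic.lateBox d)) =
      ENNReal.ofReal (∫ z in Kinetic.lateBox d, max (f z - m) 0) := by
    rw [eLpNorm_one_eq_lintegral_enorm, ← ofReal_integral_norm_eq_lintegral_enorm hmi]
    congr 2
    funext z
    exact Real.norm_of_nonneg (le_max_right _ _)
  have hg1 : ENNReal.ofReal (∫ z in U, ‖g z‖) ≤ a := by
    rw [ofReal_integral_norm_eq_lintegral_enorm hgi, ← eLpNorm_one_eq_lintegral_enorm]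
    exact haU
  have hS1 : ENNReal.ofReal (∫ z in U, ‖S z‖) ≤ ENNReal.ofReal M * b := by
    rw [ofReal_integral_norm_eq_lintegral_enorm hSi, ← eLpNorm_one_eq_lintegral_enorm, hM,
      ENNReal.ofReal_toReal hMfin, mul_comm]
    refine (eLpNorm_le_eLpNorm_mul_rpow_measure_univ (q := 2) (by norm_num)
      hSi.aestronglyMeasurable).trans ?_
    rw [Measure.restrict_apply_univ]
    gcongr
    exact eLpNorm_mono_measure S hsub
  rw [hL, ENNReal.ofReal_mul hC.le, ENNReal.ofReal_add zero_le_one hM0, ENNReal.ofReal_one,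
    mul_assoc]
  refine (ENNReal.ofReal_le_ofReal hkey).trans ?_
  rw [ENNReal.ofReal_mul hC.le, ENNReal.ofReal_add (integral_nonneg fun _ => norm_nonneg _)
    (integral_nonneg fun _ => norm_nonneg _)]
  gcongr
  calc _ ≤ a + ENNReal.ofReal M * b := add_le_add hg1 hS1
    _ ≤ (1 * a + ENNReal.ofReal M * a) + (1 * b + ENNReal.ofReal M * b) := by
        rw [one_mul, one_mul]
        exact add_le_add le_self_add le_add_self
    _ = _ := by rw [← add_mul, ← add_mul, mul_add]
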